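/- Work in the two-dimensional abstract Tile Assembly Model (aTAM). A glue is a pair of a finite string (over a fixed non-empty alphabet) and a strength in $\mathbb{N}$, with a single glue of strength $0$; a tile type is a 4-tuple of glues, one for each side of a unit square. Two adjacent tiles bind, with strength equal to the common strength of their abutting glues, if these glues are equal. An assembly is a non-empty, connected, possibly infinite partial arrangement of tiles on $\mathbb{Z}^2$, and it is $\tau$-stable if every cut of its weighted binding graph has weight at least $\tau$. A system $\mathcal{T}=(T,\sigma,\tau)$ consists of a finite set $T$ of tile types, a finite $\tau$-stable seed assembly $\sigma$ over $T$, and $\tau\in\mathbb{Z}^+$. An assembly is producible if it is the result of a finite or infinite sequence of $\tau$-stable assemblies over $T$ that starts with $\sigma$ and adds one tile at each step; it is terminal if it is $\tau$-stable and no further tile can be added $\tau$-stably. Each tile type has one color from a set of colors containing two distinct colors Black and White. The system weakly self-assembles a pattern $P$ on a set $D\subseteq\mathbb{Z}^2$ with colors from $\{\text{Black},\text{White}\}$ if in every producible terminal assembly the locations of the Black or White tiles are exactly the locations in $D$, and each of them has the color prescribed by $P$. For $n,i,j\in\mathbb{N}$ with $i,j<n$, let $\mathrm{Stripes}(n,i,j)$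 be the pattern on $\{0,\dots,n-1\}^2$ in which $(x,y)$ is Black if $x \bmod i=0$ or $y\bmod j=0$, and White otherwise (with the convention $x \bmod 0 = x$). Theorem. There is a function $f:\mathbb{N}\to\mathbb{R}$ with $f(n)=O(\log n)$ as $n\to\infty$ such that for all $n,i,j\in\mathbb{N}$ with $i,j<n$ there are an aTAM system $\mathcal{T}=(T,\sigma,2)$ (of temperature $2$) and a coloring of its tile types such that $|\sigma|=1$, $|T|\le f(n)$, and $\mathcal{T}$ weakly self-assembles $\mathrm{Stripes}(n,i,j)$. -/

import Mathlib

namespace ATAM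

/-- A glue over the alphabet `A`: a finite string label and a strength; the only glue of
strength `0` is the null glue, whose label is taken to be the empty string. -/
@[ext]
structure Glue (A : Type*) where
  label : List A
  strength : ℕ
  null_unique : strength = 0 → label = []

/-- The four sides of a unit square tile. -/
inductive Dir where
  | north
  | east
  | south
  | west

/-- The unit vector pointing out of a side. -/
def Dir.vec : Dir → ℤ × ℤ
  | north => (0, 1)
  | east => (1, 0)
  | south => (0, -1)
  | west => (-1, 0)

/-- The opposite side. -/
def Dir.opp : Dir → Dir
  | north => south
  | east => west
  | south => north
  | west => east

/-- A tile type is a 4-tuple of glues, one for each side. -/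
abbrev TileType (A : Type*) := Dir → Glue A

/-- A configuration: a partial arrangement of tiles on the lattice `ℤ²`. -/
abbrev Config (A : Type*) := ℤ × ℤ → Option (TileType A)

/-- The grid graph on `ℤ²`. -/
def gridGraph : SimpleGraph (ℤ × ℤ) where
  Adj p q := ∃ d : Dir, q = p + d.vec
  symm := ⟨by
    rintro p q ⟨d, rfl⟩
    refine ⟨d.opp, ?_⟩
    cases d <;> simp [Dir.vec, Dir.opp, add_assoc]⟩
  loopless := ⟨by
    rintro p ⟨d, h⟩
    cases d <;> simp [Dir.vec] at h⟩

namespace Config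

variable {A : Type*}

/-- The set of occupied locations (the shape of the configuration). -/
def dom (α : Config A) : Set (ℤ × ℤ) := {p | ∃ t, α p = some t}

open Classical in
/-- The weight of the edge of the binding graph that leaves location `p` through side `d`:
the common strength of the abutting glues if both locations are occupied and the two glues are
equal, and `0` (no edge) otherwise. -/
noncomputable def bond (α : Config A) (p : ℤ × ℤ) (d : Dir) : ℕ :=
  match α p, α (p + d.vec) with
  | some t, some u => if t d = u d.opp then (t d).strength else 0
  | _, _ => 0

/-- All tiles of the configuration belong to the tile set `T`. -/
def Over (α : Config A) (T : Finset (TileType A)) : Prop :=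
  ∀ p t, α p = some t → t ∈ T

/-- An assembly is a configuration whose domain is non-empty and connected in the grid. -/
def IsAssembly (α : Config A) : Prop :=
  (gridGraph.induce α.dom).Connected

/-- An assembly is `τ`-stable if every cut `(X, dom α \ X)` of its binding graph has weight at
least `τ`. An edge across the cut is given as a pair `(p, d)` with `p ∈ X` and `p + d.vec ∉ X`.
Since an assembly may be infinite, the weight of a cut may be infinite; it is at least `τ` iff
some finite set of crossing edges has total weight at least `τ`. -/
def Stable (τ : ℕ) (α : Config A) : Prop :=
  α.IsAssembly ∧
  ∀ X : Set (ℤ × ℤ), X ⊆ α.dom → X.Nonempty → X ≠ α.dom →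
    ∃ F : Finset ((ℤ × ℤ) × Dir),
      (∀ e ∈ F, e.1 ∈ X ∧ e.1 + e.2.vec ∈ α.dom \ X) ∧
      τ ≤ ∑ e ∈ F, α.bond e.1 e.2

/-- `α` is a subassembly of `β`. -/
def Sub (α β : Config A) : Prop :=
  ∀ p t, α p = some t → β p = some t

end Config

/-- A tile-assembly system: a finite tile set, a finite stable seed assembly over it, and a
positive temperature. -/
structure TAS (A : Type*) where
  tiles : Finset (TileType A)
  seed : Config A
  temp : ℕ
  temp_pos : 0 < temp
  seed_over : seed.Over tiles
  seed_finite : seed.dom.Finite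
  seed_stable : seed.Stable temp

namespace TAS

variable {A : Type*} (𝒯 : TAS A)

/-- `α` produces `β` in one step: both are stable assemblies over the tile set, and `β` is `α`
with exactly one tile added. -/
def Step (α β : Config A) : Prop :=
  α.Over 𝒯.tiles ∧ α.Stable 𝒯.temp ∧ β.Over 𝒯.tiles ∧ β.Stable 𝒯.temp ∧
  α.Sub β ∧ (β.dom \ α.dom).ncard = 1

/-- `α` produces `β`: there is an assembly sequence `s 0, s 1, …` with `k` terms, where `k` is a
positive integer or `∞`, that starts with `α` and whose result is `β`. The result consists of all
tiles of the assemblies of the sequence (for finite `k` it is the last assembly). -/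
def Produces (α β : Config A) : Prop :=
  ∃ (k : ℕ∞) (s : ℕ → Config A), 0 < k ∧ s 0 = α ∧
    (∀ i : ℕ, ((i + 1 : ℕ) : ℕ∞) < k → 𝒯.Step (s i) (s (i + 1))) ∧
    ∀ p t, β p = some t ↔ ∃ i : ℕ, (i : ℕ∞) < k ∧ s i p = some t

/-- `α` can be grown from the seed. -/
def Producible (α : Config A) : Prop := 𝒯.Produces 𝒯.seed α

/-- `α` is stable and no tile can be added to it. -/
def Terminal (α : Config A) : Prop :=
  α.Stable 𝒯.temp ∧ ¬ ∃ β, 𝒯.Step α β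

/-- With the tile types colored by `color`, the system weakly self-assembles the pattern `P`
(a set of locations with colors) with respect to the set `CP` of pattern colors: in every
producible terminal assembly, the locations of the tiles with a color in `CP` are exactly the
locations of `P`, and each of them has the color that `P` prescribes. -/
def WeaklySelfAssembles {C : Type*} (color : TileType A → C) (CP : Set C)
    (P : Set ((ℤ × ℤ) × C)) : Prop :=
  ∀ α : Config A, 𝒯.Producible α → 𝒯.Terminal α →
    {p | ∃ t, α p = some t ∧ color t ∈ CP} = Prod.fst '' P ∧
    ∀ l c, (l, c) ∈ P → ∃ t, α l = some t ∧ color t = c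

end TAS

/-- The stripes pattern on the square `[0, n-1]²`: the location `(x, y)` is black if
`x mod i = 0` or `y mod j = 0`, and white otherwise. -/
def stripes {C : Type*} (black white : C) (n i j : ℕ) : Set ((ℤ × ℤ) × C) :=
  {e | ∃ x y : ℕ, x < n ∧ y < n ∧ e.1 = ((x : ℤ), (y : ℤ)) ∧
    e.2 = if x % i = 0 ∨ y % j = 0 then black else white}

end ATAM

/-! ### Directions, bonds and stable assemblies. -/

namespace ATAM

/-! A band of `w = Nat.log 2 n + 2` rows at the bottom of the square counts columns in binary, and a
constant number of further tile types carries the results through the rest. The seed column and the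
band tiles may store their row number, at a cost of O(w) types, so the bits of all constants are
hard-coded.

The band is scanned in a snake, up in odd columns and down in even ones, by a finite machine that
runs four counters in parallel. A counter modulo `m` adds 2 on the way up and meanwhile compares the
sum with `m` and `m + 1`; on the way down it reduces the sum and compares the result with `m - 1`.
Hence, on entering a column, the machine knows whether the column number is a zero of each counter.
The four counters tell whether the column is black, whether the row of the same number is black,
whether the column is the first one outside, and whether it is column `w`.

Above the band the column flags flow north. The flag of row `y` is known in column `y`, so it must
turn at the diagonal: a staircase of tiles at `(y, y)` and `(y + 1, y)` starts at `(w, w)`, and each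
diagonal tile sends its row flag west and east.

Correctness is separated from the construction by `Blueprint`. Glues are oriented, each tile but the
seed has input strength exactly 2, and inputs that the layout offers at a location determine its
tile. Then everything that grows is part of the layout (`Grown.step`), and growth cannot stop before
the layout is filled (`Grown.eq_target`). `Scan.Run.valid` checks these conditions for any machine
run, and `counterScan_run` supplies the run. For `n < 5`, where the band need not fit, one tile type
per location suffices. -/

instance : DecidableEq Dir := fun a b => by
  cases a <;> cases b <;> first | exact isTrue rfl | exact isFalse (by rintro ⟨⟩)

instance : Fintype Dir where
  elems := {.north, .east, .south, .west}
  complete := by rintro ⟨⟩ <;> simp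

lemma Dir.sum_univ (f : Dir → ℕ) : ∑ d, f d = f .north + f .east + f .south + f .west := by
  have : (Finset.univ : Finset Dir) = {.north, .east, .south, .west} := rfl
  rw [this, Finset.sum_insert (by simp), Finset.sum_insert (by simp), Finset.sum_insert (by simp),
    Finset.sum_singleton]
  ring

@[simp] lemma Dir.opp_opp (d : Dir) : d.opp.opp = d := by cases d <;> rfl

@[simp] lemma Dir.vec_opp (d : Dir) : d.opp.vec = -d.vec := by cases d <;> simp [opp, vec]

lemma Dir.opp_injective : Function.Injective Dir.opp :=
  Function.LeftInverse.injective Dir.opp_opp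

lemma Dir.vec_ne_zero (d : Dir) : d.vec ≠ 0 := by cases d <;> simp [vec]

namespace Config

variable {A : Type*} {α β : Config A} {p : ℤ × ℤ} {t u : TileType A} {d : Dir} {τ : ℕ}

lemma mem_dom : p ∈ α.dom ↔ ∃ t, α p = some t := Iff.rfl

lemma mem_dom_of_eq (h : α p = some t) : p ∈ α.dom := ⟨t, h⟩

lemma bond_of_some (h : α p = some t) (h' : α (p + d.vec) = some u) [Decidable (t d = u d.opp)] :
    α.bond p d = if t d = u d.opp then (t d).strength else 0 := by
  unfold bond
  rw [h, h']
  split_ifs <;> simp_all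

lemma exists_of_bond_pos (h : 0 < α.bond p d) :
    ∃ t u, α p = some t ∧ α (p + d.vec) = some u ∧ t d = u d.opp ∧
      α.bond p d = (t d).strength := by
  classical
  cases h1 : α p with
  | none => simp [bond, h1] at h
  | some t =>
    cases h2 : α (p + d.vec) with
    | none => simp [bond, h1, h2] at h
    | some u =>
      rw [bond_of_some h1 h2] at h ⊢
      split_ifs at h with h3
      · exact ⟨t, u, rfl, rfl, h3, by simp [h3]⟩
      · simp at h

lemma bond_opp (α : Config A) (p : ℤ × ℤ) (d : Dir) : α.bond (p + d.vec) d.opp = α.bond p d := by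
  classical
  cases h1 : α p with
  | none => cases h2 : α (p + d.vec) <;> simp [bond, h1, h2]
  | some t =>
    cases h2 : α (p + d.vec) with
    | none => simp [bond, h1, h2]
    | some u =>
      rw [bond_of_some h1 h2, bond_of_some (t := u) (u := t) h2 (by simpa using h1)]
      by_cases h : t d = u d.opp
      · simp [h]
      · rw [if_neg h, if_neg (by simpa using fun h' => h h'.symm)]

lemma dom_mono (h : α.Sub β) : α.dom ⊆ β.dom := fun _ ⟨t, ht⟩ => ⟨t, h _ t ht⟩

lemma Sub.bond_le (h : α.Sub β) (p : ℤ × ℤ) (d : Dir) : α.bond p d ≤ β.bond p d := by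
  classical
  rcases Nat.eq_zero_or_pos (α.bond p d) with h0 | h0
  · simp [h0]
  · obtain ⟨t, u, h1, h2, h3, h4⟩ := exists_of_bond_pos h0
    rw [h4, bond_of_some (h _ _ h1) (h _ _ h2), if_pos h3]

/-- A tile that is not the only tile of a stable assembly is bound to it with strength `τ`. -/
lemma Stable.le_sum_bond (h : α.Stable τ) (hp : p ∈ α.dom) (hne : {p} ≠ α.dom) :
    τ ≤ ∑ d, α.bond p d := by
  obtain ⟨F, hF, hτ⟩ := h.2 {p} (by simpa using hp) (by simp) hne
  refine hτ.trans ?_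
  have hF' : F ⊆ Finset.univ.image (fun d : Dir => (p, d)) := by
    rintro ⟨q, d⟩ he
    have := (hF _ he).1
    simp only [Set.mem_singleton_iff] at this
    simp [this]
  refine (Finset.sum_le_sum_of_subset hF').trans ?_
  rw [Finset.sum_image (by intro a _ b _ hab; simpa using hab)]

/-- Adding a tile that is bound with strength `τ` to a stable assembly gives a stable
assembly. -/
lemma Stable.add_tile (hα : α.Stable τ) (hsub : α.Sub β) (hdom : β.dom = insert p α.dom)
    (hτ0 : 0 < τ) (hp : p ∉ α.dom) (hτ : τ ≤ ∑ d, β.bond p d) : β.Stable τ := by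
  have hnb : ∀ d, 0 < β.bond p d → p + d.vec ∈ α.dom := by
    intro d hd
    obtain ⟨t, u, -, h2, -⟩ := exists_of_bond_pos hd
    have h3 : p + d.vec ∈ insert p α.dom := hdom ▸ mem_dom_of_eq h2
    rcases h3 with h3 | h3
    · exact absurd h3 (by simpa using d.vec_ne_zero)
    · exact h3
  refine ⟨?_, ?_⟩
  · obtain ⟨d, hd⟩ : ∃ d, 0 < β.bond p d := by
      by_contra! hcon
      have : ∑ d, β.bond p d = 0 := Finset.sum_eq_zero fun d _ => Nat.le_zero.1 (hcon d)
      omega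
    have hadj : gridGraph.Adj p (p + d.vec) := ⟨d, rfl⟩
    unfold IsAssembly
    rw [hdom, Set.insert_eq]
    have h1 : (gridGraph.induce {p}).Connected := by
      have : Subsingleton ({p} : Set (ℤ × ℤ)) := Set.subsingleton_singleton.coe_sort
      have : Nonempty ({p} : Set (ℤ × ℤ)) := ⟨⟨p, rfl⟩⟩
      exact SimpleGraph.Connected.mk (fun a b => by rw [Subsingleton.elim a b])
    exact SimpleGraph.connected_induce_union (v := p) (w := p + d.vec) h1.preconnected
      hα.1.preconnected rfl (hnb d hd) hadj
  · intro X hX hne hXdom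
    -- A cut either isolates the new tile, on one side or the other, and is crossed by all its
    -- bonds, or it restricts to a proper cut of the old assembly.
    by_cases hX1 : X \ {p} = ∅
    · have hXp : X = {p} := by
        apply Set.Subset.antisymm (Set.sdiff_eq_empty.1 hX1)
        obtain ⟨x, hx⟩ := hne
        have := Set.sdiff_eq_empty.1 hX1 hx
        simp only [Set.mem_singleton_iff] at this
        simpa [← this] using hx
      refine ⟨(Finset.univ.filter fun d => 0 < β.bond p d).image fun d => (p, d), ?_, ?_⟩
      · simp only [Finset.mem_image, Finset.mem_filter, Finset.mem_univ, true_and]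
        rintro _ ⟨d, hd, rfl⟩
        refine ⟨by simp [hXp], ?_, ?_⟩
        · rw [hdom]; exact Or.inr (hnb d hd)
        · simpa [hXp] using d.vec_ne_zero
      · rw [Finset.sum_image (by intro a _ b _ hab; simpa using hab)]
        refine hτ.trans (le_of_eq ?_)
        symm
        apply Finset.sum_filter_of_ne
        intro d _ h; exact Nat.pos_of_ne_zero h
    · by_cases hX2 : X \ {p} = α.dom
      · have hpX : p ∉ X := by
          intro hpX
          apply hXdom
          rw [hdom, ← hX2, Set.insert_sdiff_singleton, Set.insert_eq_of_mem hpX]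
        refine ⟨(Finset.univ.filter fun d => 0 < β.bond p d).image
          fun d => (p + d.vec, d.opp), ?_, ?_⟩
        · simp only [Finset.mem_image, Finset.mem_filter, Finset.mem_univ, true_and]
          rintro _ ⟨d, hd, rfl⟩
          have := hnb d hd
          rw [← hX2] at this
          refine ⟨this.1, ?_, ?_⟩
          · rw [hdom]; simp
          · simpa using hpX
        · rw [Finset.sum_image (by
            intro a _ b _ hab
            exact Dir.opp_injective (by simpa using congrArg Prod.snd hab))]
          simp only [bond_opp]
          refine hτ.trans (le_of_eq ?_)
          symm
          apply Finset.sum_filter_of_ne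
          intro d _ h; exact Nat.pos_of_ne_zero h
      · have hXα : X \ {p} ⊆ α.dom := by
          rintro x ⟨hx, hxp⟩
          have := hX hx
          rw [hdom] at this
          exact this.resolve_left hxp
        obtain ⟨F, hF, hFτ⟩ := hα.2 _ hXα (Set.nonempty_iff_ne_empty.2 hX1) hX2
        refine ⟨F, fun e he => ?_, hFτ.trans (Finset.sum_le_sum fun e _ => hsub.bond_le _ _)⟩
        obtain ⟨h1, h2, h3⟩ := hF e he
        refine ⟨h1.1, dom_mono hsub h2, fun h4 => h3 ⟨h4, ?_⟩⟩
        rintro rfl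
        exact hp h2

/-- The configuration with a single tile. -/
noncomputable def single (p : ℤ × ℤ) (t : TileType A) : Config A :=
  open Classical in fun q => if q = p then some t else none

lemma single_eq_some {q : ℤ × ℤ} : single p t q = some u ↔ q = p ∧ t = u := by
  unfold single; split_ifs <;> simp_all

@[simp] lemma dom_single : (single p t).dom = {p} := by
  ext q; simp [mem_dom, single_eq_some]

lemma stable_single : (single p t).Stable τ := by
  refine ⟨?_, ?_⟩
  · unfold IsAssembly
    rw [dom_single]
    have : Subsingleton ({p} : Set (ℤ × ℤ)) := Set.subsingleton_singleton.coe_sort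
    have : Nonempty ({p} : Set (ℤ × ℤ)) := ⟨⟨p, rfl⟩⟩
    exact SimpleGraph.Connected.mk (fun a b => by rw [Subsingleton.elim a b])
  · intro X hX hne hX2
    rw [dom_single] at hX hX2
    exact absurd (hne.subset_singleton_iff.1 hX) hX2

end Config
-- Blueprints: local conditions under which growth fills the layout.
/-- A description of a tile system at temperature `2` and of the arrangement that it is to grow.
Every glue has a direction of flow: a side of a tile is an input side if its glue flows into the
tile, and an output side if its glue flows out. -/
structure Blueprint (G N : Type*) where
  flow : G → Dir
  strong : G → Bool
  side : N → Dir → Option G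
  names : Finset N
  layout : ℤ × ℤ → Option N
  origin : ℤ × ℤ
  rank : ℤ × ℤ → ℕ

namespace Blueprint

variable {G N A C : Type*} (B : Blueprint G N)

def str (g : G) : ℕ := 1 + (B.strong g).toNat

lemma str_pos (g : G) : 0 < B.str g := by unfold str; omega

/-- The glue `g` flows into the tile `t` through the side `d`. -/
def IsInput (t : N) (d : Dir) (g : G) : Prop := B.side t d = some g ∧ B.flow g = d.opp

def inputStr (t : N) (d : Dir) : ℕ :=
  match B.side t d with
  | some g => if B.flow g = d.opp then B.str g else 0
  | none => 0

variable {B} in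
lemma IsInput.inputStr {t : N} {d : Dir} {g : G} (h : B.IsInput t d g) :
    B.inputStr t d = B.str g := by
  simp [Blueprint.inputStr, h.1, h.2]

/-- The layout contains neighbours that offer all the inputs of the tile `t` at `p`. -/
def InputsMatch (t : N) (p : ℤ × ℤ) : Prop :=
  ∀ d g, B.IsInput t d g → ∃ u, B.layout (p + d.vec) = some u ∧ B.side u d.opp = some g

/-- The tiles bind by exactly their inputs, the inputs at a location determine the tile, and the
layout can be grown in the order of increasing rank. -/
structure Valid : Prop where
  flow_axis : ∀ t ∈ B.names, ∀ d g, B.side t d = some g → B.flow g = d ∨ B.flow g = d.opp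
  input_le : ∀ t ∈ B.names, ∑ d, B.inputStr t d ≤ 2
  unique : ∀ t ∈ B.names, ∀ p, ∑ d, B.inputStr t d = 2 → B.InputsMatch t p →
    B.layout p = some t
  layout_mem : ∀ p t, B.layout p = some t → t ∈ B.names
  layout_match : ∀ p t, B.layout p = some t → B.InputsMatch t p
  layout_rank : ∀ p t d g, B.layout p = some t → B.IsInput t d g →
    B.rank (p + d.vec) < B.rank p
  layout_strength : ∀ p t, B.layout p = some t → p ≠ B.origin → ∑ d, B.inputStr t d = 2
  layout_origin : ∃ t, B.layout B.origin = some t ∧ ∑ d, B.inputStr t d = 0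

variable (enc : G → ℕ) (a : A)

/-- Labels are unary because the alphabet may have only one letter. -/
def toGlue : Option G → Glue A
  | none => ⟨[], 0, fun _ => rfl⟩
  | some g => ⟨List.replicate (enc g + 1) a, B.str g, fun h => absurd h (B.str_pos g).ne'⟩

lemma toGlue_injective (henc : Function.Injective enc) :
    Function.Injective (B.toGlue enc a) := by
  rintro (_ | g) (_ | g') h
  · rfl
  · simp [toGlue, List.replicate_succ] at h
  · simp [toGlue, List.replicate_succ] at h
  · have := congrArg (fun x => x.label.length) h
    simp only [toGlue, List.length_replicate, Nat.add_right_cancel_iff] at this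
    rw [henc this]

def tile (t : N) : TileType A := fun d => B.toGlue enc a (B.side t d)

/-- The configuration that the blueprint describes. -/
def target : Config A := fun p => (B.layout p).map (B.tile enc a)

lemma target_eq_some {p : ℤ × ℤ} {t : TileType A} :
    B.target enc a p = some t ↔ ∃ n, B.layout p = some n ∧ B.tile enc a n = t := by
  simp [target]

open Classical in
/-- The tile system of a blueprint. -/
noncomputable def system (hB : B.Valid) : TAS A where
  tiles := B.names.image (B.tile enc a)
  seed := Config.single B.origin (B.tile enc a hB.layout_origin.choose)
  temp := 2
  temp_pos := by norm_num
  seed_over := by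
    intro p t h
    rw [Config.single_eq_some] at h
    rw [← h.2]
    exact Finset.mem_image_of_mem _ (hB.layout_mem _ _ hB.layout_origin.choose_spec.1)
  seed_finite := by simp
  seed_stable := Config.stable_single

/-- A part of the target that contains the seed, and with every tile the tiles that provide its
inputs. -/
structure Grown (α : Config A) : Prop where
  origin_mem : B.origin ∈ α.dom
  sub : α.Sub (B.target enc a)
  closed : ∀ p ∈ α.dom, ∀ n, B.layout p = some n → ∀ d g, B.IsInput n d g → p + d.vec ∈ α.dom

variable {B enc a}

lemma grown_seed (hB : B.Valid) : B.Grown enc a (B.system enc a hB).seed where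
  origin_mem := by simp [system]
  sub := by
    intro p t h
    simp only [system, Config.single_eq_some] at h
    rw [target_eq_some, h.1]
    exact ⟨_, hB.layout_origin.choose_spec.1, h.2⟩
  closed := by
    intro p hp n hn d g hg
    simp only [system, Config.dom_single, Set.mem_singleton_iff] at hp
    obtain ⟨t, h1, h2⟩ := hB.layout_origin
    rw [hp, h1] at hn
    cases hn
    have h3 := Finset.sum_eq_zero_iff.1 h2 d (Finset.mem_univ _)
    rw [hg.inputStr] at h3
    exact absurd h3 (B.str_pos g).ne'

/-- The new tile cannot bind through an output: that glue would be an input of a neighbour already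
present, whose inputs are all occupied. So it binds by inputs alone, needs all of them, and is the
tile that the layout prescribes there. -/
lemma Grown.step (henc : Function.Injective enc) (hB : B.Valid) {α β : Config A}
    (hα : B.Grown enc a α) (h : (B.system enc a hB).Step α β) : B.Grown enc a β := by
  classical
  obtain ⟨-, -, hover, hstab, hsub, hcard⟩ := h
  obtain ⟨p, hp⟩ := Set.ncard_eq_one.1 hcard
  have hpβ : p ∈ β.dom := (hp.ge rfl : p ∈ β.dom \ α.dom).1
  have hpα : p ∉ α.dom := (hp.ge rfl : p ∈ β.dom \ α.dom).2
  have hdom : ∀ q ∈ β.dom, q = p ∨ q ∈ α.dom := by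
    intro q hq
    by_cases hqα : q ∈ α.dom
    · exact Or.inr hqα
    · exact Or.inl (hp.le ⟨hq, hqα⟩)
  have hαβ : ∀ q ∈ α.dom, β q = α q := by
    rintro q ⟨t, ht⟩
    rw [ht, hsub q t ht]
  have hmono := Config.dom_mono hsub
  obtain ⟨t, ht⟩ := hpβ
  obtain ⟨n, hn, rfl⟩ := Finset.mem_image.1 (hover p t ht)
  have hsum : 2 ≤ ∑ d, β.bond p d := by
    refine hstab.le_sum_bond ⟨_, ht⟩ fun h => hpα ?_
    have := h.ge (hmono hα.origin_mem)
    rw [Set.mem_singleton_iff] at this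
    exact this ▸ hα.origin_mem
  have key : ∀ d, 0 < β.bond p d → β.bond p d = B.inputStr n d ∧ p + d.vec ∈ α.dom ∧
      ∃ u, B.layout (p + d.vec) = some u ∧ B.side u d.opp = B.side n d := by
    intro d hd
    obtain ⟨t', u, h1, h2, h3, h4⟩ := Config.exists_of_bond_pos hd
    rw [ht] at h1
    cases h1
    have hq : p + d.vec ∈ α.dom := (hdom _ ⟨u, h2⟩).resolve_left (by simpa using d.vec_ne_zero)
    rw [hαβ _ hq] at h2
    obtain ⟨m, hm, rfl⟩ := (B.target_eq_some enc a).1 (hα.sub _ _ h2)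
    have h5 : B.side n d = B.side m d.opp := B.toGlue_injective enc a henc h3
    refine ⟨?_, hq, m, hm, h5.symm⟩
    cases hg : B.side n d with
    | none => rw [h4] at hd; simp [tile, toGlue, hg] at hd
    | some g =>
      -- If the glue flows out of the new tile, it flows into the neighbour, and `closed` puts `p`
      -- in the old assembly.
      rcases hB.flow_axis n hn d g hg with hf | hf
      · refine absurd (hα.closed _ hq m hm d.opp g ⟨h5 ▸ hg, by simpa using hf⟩) ?_
        simpa using hpα
      · rw [h4, IsInput.inputStr ⟨hg, hf⟩]
        simp [tile, toGlue, hg]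
  have hle : ∀ d ∈ Finset.univ, β.bond p d ≤ B.inputStr n d := by
    intro d _
    rcases Nat.eq_zero_or_pos (β.bond p d) with h0 | h0
    · omega
    · exact (key d h0).1.le
  have hle2 := hB.input_le n hn
  have hle3 := Finset.sum_le_sum hle
  -- The bonds sum to at least 2 and the inputs that bound them to at most 2, so equality holds side
  -- by side.
  have heq := (Finset.sum_eq_sum_iff_of_le hle).1 (by omega)
  have hin : ∀ d g, B.IsInput n d g → 0 < β.bond p d := by
    intro d g hg
    rw [heq d (Finset.mem_univ _), hg.inputStr]
    exact B.str_pos g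
  have hlay : B.layout p = some n := by
    refine hB.unique n hn p (by omega) fun d g hg => ?_
    obtain ⟨-, -, u, hu, hu'⟩ := key d (hin d g hg)
    exact ⟨u, hu, hu'.trans hg.1⟩
  refine ⟨hmono hα.origin_mem, fun q t' hq => ?_, fun q hq m hm d g hg => ?_⟩
  · rcases hdom q ⟨t', hq⟩ with rfl | hqα
    · rw [target_eq_some]
      rw [ht] at hq
      exact ⟨n, hlay, Option.some_injective _ hq⟩
    · exact hα.sub _ _ (hαβ q hqα ▸ hq)
  · rcases hdom q hq with rfl | hqα
    · rw [hlay] at hm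
      cases hm
      exact hmono (key d (hin d g hg)).2.1
    · exact hmono (hα.closed q hqα m hm d g hg)

lemma grown_of_producible (henc : Function.Injective enc) (hB : B.Valid) {α : Config A}
    (h : (B.system enc a hB).Producible α) : B.Grown enc a α := by
  obtain ⟨k, s, hk, h0, hs, hα⟩ := h
  have hgr : ∀ i : ℕ, (i : ℕ∞) < k → B.Grown enc a (s i) := by
    intro i
    induction i with
    | zero => intro _; rw [h0]; exact grown_seed hB
    | succ i ih =>
      intro hi
      exact (ih (lt_of_le_of_lt (by exact_mod_cast i.le_succ) hi)).step henc hB (hs i hi)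
  have hmem : ∀ i : ℕ, (i : ℕ∞) < k → ∀ q ∈ (s i).dom, q ∈ α.dom := by
    rintro i hi q ⟨t, ht⟩
    exact ⟨t, (hα q t).2 ⟨i, hi, ht⟩⟩
  refine ⟨hmem 0 (by simpa using hk) _ (hgr 0 (by simpa using hk)).origin_mem, ?_, ?_⟩
  · intro p t ht
    obtain ⟨i, hi, h⟩ := (hα p t).1 ht
    exact (hgr i hi).sub p t h
  · rintro p ⟨t, ht⟩ n hn d g hg
    obtain ⟨i, hi, h⟩ := (hα p t).1 ht
    exact hmem i hi _ ((hgr i hi).closed p ⟨t, h⟩ n hn d g hg)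

/-- By induction on the rank, the providers of the inputs of a missing tile are present, so the tile
could be added, against terminality. -/
lemma Grown.eq_target (hB : B.Valid) {α : Config A} (hα : B.Grown enc a α)
    (hterm : (B.system enc a hB).Terminal α) : α = B.target enc a := by
  classical
  have hnames : ∀ q t, B.target enc a q = some t → t ∈ (B.system enc a hB).tiles := by
    intro q t hq
    obtain ⟨m, hm, rfl⟩ := (B.target_eq_some enc a).1 hq
    exact Finset.mem_image_of_mem _ (hB.layout_mem _ _ hm)
  have hmem : ∀ r p, B.rank p = r → ∀ n, B.layout p = some n → p ∈ α.dom := by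
    intro r
    induction r using Nat.strong_induction_on with
    | _ r ih =>
      intro p hr n hn
      by_contra hp
      have hpo : p ≠ B.origin := fun h => hp (h ▸ hα.origin_mem)
      set β : Config A := Function.update α p (some (B.tile enc a n)) with hβ
      have hβp : β p = some (B.tile enc a n) := by simp [hβ]
      have hβq : ∀ q, q ≠ p → β q = α q := fun q hq => by simp [hβ, hq]
      have hsub : α.Sub β := by
        intro q t hq
        rw [hβq, hq]
        rintro rfl
        exact hp ⟨t, hq⟩
      have hdom : β.dom = insert p α.dom := by
        ext q
        by_cases hq : q = p
        · subst hq; simp [Config.mem_dom, hβp]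
        · simp [Config.mem_dom, hβq q hq, hq]
      have hbond : ∀ d, B.inputStr n d ≤ β.bond p d := by
        intro d
        cases hg : B.side n d with
        | none => simp [inputStr, hg]
        | some g =>
          by_cases hf : B.flow g = d.opp
          · have hi : B.IsInput n d g := ⟨hg, hf⟩
            obtain ⟨u, hu, hu'⟩ := hB.layout_match p n hn d g hi
            obtain ⟨t, ht⟩ := ih _ (hr ▸ hB.layout_rank p n d g hn hi) _ rfl u hu
            obtain ⟨m, hm, rfl⟩ := (B.target_eq_some enc a).1 (hα.sub _ _ ht)
            rw [hu] at hm
            cases hm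
            rw [hi.inputStr, Config.bond_of_some hβp (hsub _ _ ht), if_pos]
            · simp [tile, toGlue, hg]
            · simp [tile, hg, hu']
          · simp [inputStr, hg, hf]
      have hstab : β.Stable 2 := by
        refine hterm.1.add_tile hsub hdom two_pos hp ?_
        refine (hB.layout_strength p n hn hpo).ge.trans ?_
        exact Finset.sum_le_sum fun d _ => hbond d
      have hover : α.Over (B.system enc a hB).tiles := fun q t hq => hnames q t (hα.sub q t hq)
      refine hterm.2 ⟨β, hover, hterm.1, ?_, hstab, hsub, ?_⟩
      · intro q t hq
        by_cases hqp : q = p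
        · refine hnames q t ((B.target_eq_some enc a).2 ⟨n, hqp ▸ hn, ?_⟩)
          rw [hqp, hβp] at hq
          exact Option.some_injective _ hq
        · exact hover q t (hβq q hqp ▸ hq)
      · rw [hdom, Set.ncard_eq_one]
        exact ⟨p, by rw [Set.insert_sdiff_of_notMem _ hp, Set.sdiff_self]; simp⟩
  funext p
  cases hp : B.target enc a p with
  | none =>
    cases hp' : α p with
    | none => rfl
    | some t => rw [hα.sub p t hp'] at hp; simp at hp
  | some t =>
    obtain ⟨n, hn, rfl⟩ := (B.target_eq_some enc a).1 hp
    obtain ⟨t, ht⟩ := hmem _ p rfl n hn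
    rw [ht, ← hp, hα.sub p t ht]

/-- Needed for colors to be well defined on tile types: different names could in principle have the
same four glues. Away from the origin the inputs at the location determine the name; at the origin
the input strength 0 distinguishes the seed. -/
lemma name_eq_of_tile_eq (henc : Function.Injective enc) (hB : B.Valid) {p q : ℤ × ℤ} {m n : N}
    (hm : B.layout p = some m) (hn : B.layout q = some n)
    (h : B.tile enc a m = B.tile enc a n) : m = n := by
  have hside : B.side m = B.side n := by
    funext d
    exact B.toGlue_injective enc a henc (congrFun h d)
  have hin : ∀ d, B.inputStr m d = B.inputStr n d := fun d => by simp [inputStr, hside]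
  have hsum : ∑ d, B.inputStr m d = ∑ d, B.inputStr n d := Finset.sum_congr rfl fun d _ => hin d
  by_cases hp : p = B.origin
  · obtain ⟨t, h1, h2⟩ := hB.layout_origin
    rw [hp, h1] at hm
    cases hm
    by_cases hq : q = B.origin
    · rw [hq, h1] at hn
      exact Option.some_injective _ hn
    · have := hB.layout_strength q n hn hq
      omega
  · have h2 := hB.layout_strength p m hm hp
    have h3 : B.layout p = some n := by
      refine hB.unique n (hB.layout_mem q n hn) p (hsum ▸ h2) fun d g hg => ?_
      exact hB.layout_match p m hm d g ⟨hside ▸ hg.1, hg.2⟩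
    rw [hm] at h3
    exact Option.some_injective _ h3

/-- The system of a valid blueprint weakly self-assembles every coloring of its layout. -/
theorem Valid.exists_system [Countable G] (hB : B.Valid) [Nonempty A] (black white : C)
    (n i j : ℕ) (isBlack : N → Prop)
    (hsquare : ∀ p, B.layout p ≠ none ↔ ∃ x y : ℕ, x < n ∧ y < n ∧ p = ((x : ℤ), (y : ℤ)))
    (hblack : ∀ (x y : ℕ) t, B.layout ((x : ℤ), (y : ℤ)) = some t →
      (isBlack t ↔ x % i = 0 ∨ y % j = 0)) :
    ∃ (𝒯 : TAS A) (color : TileType A → C), 𝒯.temp = 2 ∧ 𝒯.seed.dom.ncard = 1 ∧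
      𝒯.tiles.card ≤ B.names.card ∧
      𝒯.WeaklySelfAssembles color {black, white} (stripes black white n i j) := by
  classical
  obtain ⟨enc, henc⟩ := exists_injective_nat G
  let a : A := Classical.arbitrary A
  let color : TileType A → C := fun t =>
    if ∃ p m, B.layout p = some m ∧ B.tile enc a m = t ∧ isBlack m then black else white
  have hcolor : ∀ p m, B.layout p = some m →
      color (B.tile enc a m) = if isBlack m then black else white := by
    intro p m hm
    by_cases hb : isBlack m
    · rw [if_pos hb]
      exact if_pos ⟨p, m, hm, rfl, hb⟩
    · rw [if_neg hb]
      refine if_neg ?_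
      rintro ⟨q, m', hq, ht, hb'⟩
      exact hb (name_eq_of_tile_eq henc hB hq hm ht ▸ hb')
  refine ⟨B.system enc a hB, color, rfl, by simp [system], Finset.card_image_le, ?_⟩
  intro α hprod hterm
  rw [(grown_of_producible henc hB hprod).eq_target hB hterm]
  refine ⟨?_, ?_⟩
  · ext p
    constructor
    · rintro ⟨t, ht, -⟩
      obtain ⟨m, hm, rfl⟩ := (B.target_eq_some enc a).1 ht
      obtain ⟨x, y, hx, hy, rfl⟩ := (hsquare p).1 (by simp [hm])
      exact ⟨(_, _), ⟨x, y, hx, hy, rfl, rfl⟩, rfl⟩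
    · rintro ⟨⟨l, c⟩, ⟨x, y, hx, hy, hl, -⟩, rfl⟩
      obtain ⟨m, hm⟩ := Option.ne_none_iff_exists'.1 ((hsquare l).2 ⟨x, y, hx, hy, hl⟩)
      refine ⟨_, (B.target_eq_some enc a).2 ⟨m, hm, rfl⟩, ?_⟩
      rw [hcolor l m hm]
      split_ifs <;> simp
  · rintro l c ⟨x, y, hx, hy, hl, hc⟩
    simp only at hl hc
    subst hl
    obtain ⟨m, hm⟩ := Option.ne_none_iff_exists'.1 ((hsquare _).2 ⟨x, y, hx, hy, rfl⟩)
    refine ⟨_, (B.target_eq_some enc a).2 ⟨m, hm, rfl⟩, ?_⟩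
    rw [hcolor _ m hm, hc]
    simp only [hblack x y m hm]

end Blueprint
-- Layouts on a square.
variable {N : Type*}

/-- The arrangement of `f x y` at the locations `(x, y)` of the square of side `n`. -/
def gridLayout (n : ℕ) (f : ℕ → ℕ → N) (p : ℤ × ℤ) : Option N :=
  if 0 ≤ p.1 ∧ p.1 < n ∧ 0 ≤ p.2 ∧ p.2 < n then some (f p.1.toNat p.2.toNat) else none

lemma gridLayout_eq_some {n : ℕ} {f : ℕ → ℕ → N} {p : ℤ × ℤ} {t : N} :
    gridLayout n f p = some t ↔
      ∃ x y : ℕ, x < n ∧ y < n ∧ p = ((x : ℤ), (y : ℤ)) ∧ f x y = t := by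
  unfold gridLayout
  constructor
  · intro h
    split_ifs at h with hp
    obtain ⟨h1, h2, h3, h4⟩ := hp
    refine ⟨p.1.toNat, p.2.toNat, by omega, by omega, ?_, Option.some_injective _ h⟩
    ext <;> simp [h1, h3]
  · rintro ⟨x, y, hx, hy, rfl, rfl⟩
    rw [if_pos ⟨by simp, by simpa using hx, by simp, by simpa using hy⟩]
    simp

lemma gridLayout_coe {n : ℕ} {f : ℕ → ℕ → N} {x y : ℕ} (hx : x < n) (hy : y < n) :
    gridLayout n f ((x : ℤ), (y : ℤ)) = some (f x y) :=
  gridLayout_eq_some.2 ⟨x, y, hx, hy, rfl, rfl⟩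

lemma gridLayout_ne_none {n : ℕ} {f : ℕ → ℕ → N} {p : ℤ × ℤ} :
    gridLayout n f p ≠ none ↔ ∃ x y : ℕ, x < n ∧ y < n ∧ p = ((x : ℤ), (y : ℤ)) := by
  rw [Option.ne_none_iff_exists']
  simp only [gridLayout_eq_some]
  constructor
  · rintro ⟨_, x, y, hx, hy, hp, -⟩; exact ⟨x, y, hx, hy, hp⟩
  · rintro ⟨x, y, hx, hy, hp⟩; exact ⟨_, x, y, hx, hy, hp, rfl⟩

lemma gridLayout_west {n : ℕ} {f : ℕ → ℕ → N} {p : ℤ × ℤ} {t : N}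
    (h : gridLayout n f (p + Dir.west.vec) = some t) :
    ∃ x y : ℕ, x < n ∧ y < n ∧ p = (((x + 1 : ℕ) : ℤ), (y : ℤ)) ∧ f x y = t := by
  obtain ⟨x, y, hx, hy, hp, ht⟩ := gridLayout_eq_some.1 h
  refine ⟨x, y, hx, hy, ?_, ht⟩
  obtain ⟨a, b⟩ := p
  simp only [Dir.vec, Prod.mk_add_mk, Prod.mk.injEq] at hp ⊢
  omega

lemma gridLayout_south {n : ℕ} {f : ℕ → ℕ → N} {p : ℤ × ℤ} {t : N}
    (h : gridLayout n f (p + Dir.south.vec) = some t) :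
    ∃ x y : ℕ, x < n ∧ y < n ∧ p = ((x : ℤ), ((y + 1 : ℕ) : ℤ)) ∧ f x y = t := by
  obtain ⟨x, y, hx, hy, hp, ht⟩ := gridLayout_eq_some.1 h
  refine ⟨x, y, hx, hy, ?_, ht⟩
  obtain ⟨a, b⟩ := p
  simp only [Dir.vec, Prod.mk_add_mk, Prod.mk.injEq] at hp ⊢
  omega

lemma gridLayout_east {n : ℕ} {f : ℕ → ℕ → N} {p : ℤ × ℤ} {t : N}
    (h : gridLayout n f (p + Dir.east.vec) = some t) :
    ∃ x y : ℕ, x < n ∧ y < n ∧ p = ((x : ℤ) - 1, (y : ℤ)) ∧ f x y = t := by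
  obtain ⟨x, y, hx, hy, hp, ht⟩ := gridLayout_eq_some.1 h
  refine ⟨x, y, hx, hy, ?_, ht⟩
  obtain ⟨a, b⟩ := p
  simp only [Dir.vec, Prod.mk_add_mk, Prod.mk.injEq] at hp ⊢
  omega

lemma gridLayout_north {n : ℕ} {f : ℕ → ℕ → N} {p : ℤ × ℤ} {t : N}
    (h : gridLayout n f (p + Dir.north.vec) = some t) :
    ∃ x y : ℕ, x < n ∧ y < n ∧ p = ((x : ℤ), (y : ℤ) - 1) ∧ f x y = t := by
  obtain ⟨x, y, hx, hy, hp, ht⟩ := gridLayout_eq_some.1 h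
  refine ⟨x, y, hx, hy, ?_, ht⟩
  obtain ⟨a, b⟩ := p
  simp only [Dir.vec, Prod.mk_add_mk, Prod.mk.injEq] at hp ⊢
  omega

lemma gridLayout_add_west {n : ℕ} {f : ℕ → ℕ → N} {x y : ℕ} (hx : x < n) (hy : y < n) :
    gridLayout n f ((((x + 1 : ℕ) : ℤ), (y : ℤ)) + Dir.west.vec) = some (f x y) := by
  simpa [Dir.vec] using gridLayout_coe (f := f) hx hy

lemma gridLayout_add_south {n : ℕ} {f : ℕ → ℕ → N} {x y : ℕ} (hx : x < n) (hy : y < n) :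
    gridLayout n f (((x : ℤ), ((y + 1 : ℕ) : ℤ)) + Dir.south.vec) = some (f x y) := by
  simpa [Dir.vec] using gridLayout_coe (f := f) hx hy

lemma gridLayout_add_east {n : ℕ} {f : ℕ → ℕ → N} {x y : ℕ} (hx : x + 1 < n) (hy : y < n) :
    gridLayout n f (((x : ℤ), (y : ℤ)) + Dir.east.vec) = some (f (x + 1) y) := by
  simpa [Dir.vec] using gridLayout_coe (f := f) hx hy

lemma gridLayout_add_north {n : ℕ} {f : ℕ → ℕ → N} {x y : ℕ} (hx : x < n) (hy : y + 1 < n) :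
    gridLayout n f (((x : ℤ), (y : ℤ)) + Dir.north.vec) = some (f x (y + 1)) := by
  simpa [Dir.vec] using gridLayout_coe (f := f) hx hy

/-! ### Small squares: one tile type per location. -/

/-- A square in which every location has a tile type of its own: the bottom row grows to the east,
and from it all columns grow to the north. A glue `(x, y, b)` leads to the location `(x, y)`. -/
def combBlueprint (n : ℕ) : Blueprint (ℕ × ℕ × Bool) (ℕ × ℕ) where
  flow g := if g.2.2 then .east else .north
  strong _ := true
  side t
    | .north => some (t.1, t.2 + 1, false)
    | .south => if t.2 = 0 then none else some (t.1, t.2, false)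
    | .east => if t.2 = 0 then some (t.1 + 1, 0, true) else none
    | .west => if t.2 = 0 ∧ t.1 ≠ 0 then some (t.1, 0, true) else none
  names := Finset.range n ×ˢ Finset.range n
  layout := gridLayout n Prod.mk
  origin := (0, 0)
  rank p := p.1.toNat + p.2.toNat

lemma combBlueprint_input {n : ℕ} {t : ℕ × ℕ} {d : Dir} {g : ℕ × ℕ × Bool}
    (h : (combBlueprint n).IsInput t d g) :
    d = .west ∧ t.2 = 0 ∧ t.1 ≠ 0 ∧ g = (t.1, 0, true) ∨
      d = .south ∧ t.2 ≠ 0 ∧ g = (t.1, t.2, false) := by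
  obtain ⟨h1, h2⟩ := h
  cases d <;> simp only [combBlueprint] at h1 h2 <;> (try split_ifs at h1) <;>
    cases h1 <;> simp_all [Dir.opp]

lemma combBlueprint_sum (n : ℕ) (t : ℕ × ℕ) :
    ∑ d, (combBlueprint n).inputStr t d = if t = (0, 0) then 0 else 2 := by
  obtain ⟨x, y⟩ := t
  rw [Dir.sum_univ]
  rcases Nat.eq_zero_or_pos x with rfl | hx <;> rcases Nat.eq_zero_or_pos y with rfl | hy <;>
    simp_all [combBlueprint, Blueprint.inputStr, Blueprint.str, Dir.opp, Nat.pos_iff_ne_zero]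

lemma combBlueprint_valid {n : ℕ} (hn : 0 < n) : (combBlueprint n).Valid where
  flow_axis := by
    intro t _ d g h
    cases d <;> simp only [combBlueprint] at h ⊢ <;> (try split_ifs at h) <;>
      cases h <;> simp [Dir.opp]
  input_le t _ := by rw [combBlueprint_sum]; split_ifs <;> simp
  unique := by
    rintro ⟨x, y⟩ ht p hsum hm
    have ht' : x < n ∧ y < n := by simpa [combBlueprint] using ht
    rw [combBlueprint_sum] at hsum
    suffices h : p = ((x : ℤ), (y : ℤ)) by
      rw [h]; exact gridLayout_coe ht'.1 ht'.2
    by_cases hy : y = 0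
    · have hx : x ≠ 0 := by rintro rfl; simp [hy] at hsum
      obtain ⟨u, h1, h2⟩ := hm .west (x, 0, true)
        ⟨by simp [combBlueprint, hy, hx], by simp [combBlueprint, Dir.opp]⟩
      obtain ⟨x', y', -, -, rfl, rfl⟩ := gridLayout_west h1
      simp only [combBlueprint, Dir.opp] at h2
      split_ifs at h2 with h3
      simp_all
    · obtain ⟨u, h1, h2⟩ := hm .south (x, y, false)
        ⟨by simp [combBlueprint, hy], by simp [combBlueprint, Dir.opp]⟩
      obtain ⟨x', y', -, -, rfl, rfl⟩ := gridLayout_south h1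
      simp only [combBlueprint, Dir.opp] at h2
      simp at h2
      simp [← h2.1, ← h2.2]
  layout_mem := by
    intro p t h
    obtain ⟨x, y, hx, hy, -, rfl⟩ := gridLayout_eq_some.1 h
    simp [combBlueprint, hx, hy]
  layout_match := by
    intro p t h d g hg
    obtain ⟨x, y, hx, hy, rfl, rfl⟩ := gridLayout_eq_some.1 h
    rcases combBlueprint_input hg with ⟨rfl, rfl, h0, rfl⟩ | ⟨rfl, h0, rfl⟩
    · obtain ⟨x, rfl⟩ := Nat.exists_eq_succ_of_ne_zero h0
      exact ⟨_, gridLayout_add_west (Nat.lt_of_succ_lt hx) hy, by simp [combBlueprint, Dir.opp]⟩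
    · obtain ⟨y, rfl⟩ := Nat.exists_eq_succ_of_ne_zero h0
      exact ⟨_, gridLayout_add_south hx (Nat.lt_of_succ_lt hy), by simp [combBlueprint, Dir.opp]⟩
  layout_rank := by
    intro p t d g h hg
    obtain ⟨x, y, hx, hy, rfl, rfl⟩ := gridLayout_eq_some.1 h
    rcases combBlueprint_input hg with ⟨rfl, h1, h0, rfl⟩ | ⟨rfl, h0, rfl⟩ <;>
      simp only [combBlueprint, Dir.vec, Prod.mk_add_mk] at * <;> omega
  layout_strength := by
    intro p t h hp
    obtain ⟨x, y, hx, hy, rfl, rfl⟩ := gridLayout_eq_some.1 h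
    rw [combBlueprint_sum, if_neg]
    intro h0
    simp only [Prod.mk.injEq] at h0
    exact hp (by simp [h0.1, h0.2, combBlueprint])
  layout_origin := ⟨(0, 0), by
    simpa [combBlueprint] using gridLayout_coe (f := Prod.mk) (x := 0) (y := 0) hn hn, by
    rw [combBlueprint_sum, if_pos rfl]⟩

theorem exists_system_card_le_sq {A C : Type*} [Nonempty A] (black white : C) {n : ℕ}
    (hn : 0 < n) (i j : ℕ) :
    ∃ (𝒯 : TAS A) (color : TileType A → C), 𝒯.temp = 2 ∧ 𝒯.seed.dom.ncard = 1 ∧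
      𝒯.tiles.card ≤ n * n ∧
      𝒯.WeaklySelfAssembles color {black, white} (stripes black white n i j) := by
  have := (combBlueprint_valid hn).exists_system (A := A) black white n i j
    (fun t => t.1 % i = 0 ∨ t.2 % j = 0) (fun p => gridLayout_ne_none) (by
      intro x y t h
      obtain ⟨x', y', -, -, h1, rfl⟩ := gridLayout_eq_some.1 h
      simp only [Prod.mk.injEq, Nat.cast_inj] at h1
      simp [h1.1, h1.2])
  simpa [combBlueprint] using this

/-! ### The square system of a scanning machine. -/

/-- What the tiles of a column know about their column: whether the column is black, whether the row
of the same number is black, whether the number of the column is the side of the square (so that the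
column is the first one outside), and whether the diagonal above the band starts in the column. -/
abbrev Flags := Fin 4 → Bool

/-- The glues of the square system, where a band of `w` rows at the bottom computes the flags of
the columns, and the rest of the square distributes them. -/
inductive SquareGlue (Q S : Type*)
  | seed (k : ℕ)
  | turn (up : Bool) (s : S) (q : Q)
  | row (k : ℕ) (up : Bool) (s : S)
  | lift (k : ℕ) (q : Q)
  | drop (k : ℕ) (q : Q)
  | col (fl : Flags)
  | diagCol (fl : Flags)
  | rowE (b : Bool)
  | diagRow (b : Bool)
  | rowW (b : Bool)
deriving Countable

/-- The tiles of the square system. -/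
inductive SquareTile (Q S : Type*)
  | seed (k : ℕ)
  | band (up : Bool) (k : ℕ) (q : Q) (s : S)
  | above (fl : Flags) (b : Bool)
  | diag (fl : Flags)
  | sub (fl : Flags) (b : Bool)
  | below (fl : Flags) (b : Bool)

/-- A machine that scans the columns of a band of `w` rows, upwards in the columns with odd numbers
and downwards in the other ones. In row `k` it changes its state from `q` to `next _ k q s`, when it
reads `s` in the previous column, and it writes `out _ k q s`. In the last row of a column, the new
state is the one with which it enters the next column. A run of the machine from column `1` on in
a square of side `n` is given by the states `q x y` and the symbols `s x y` that it reads. -/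
structure Scan (Q S : Type*) where
  n : ℕ
  w : ℕ
  next : Bool → ℕ → Q → S → Q
  out : Bool → ℕ → Q → S → S
  flags : Q → Flags
  q : ℕ → ℕ → Q
  s : ℕ → ℕ → S
  φ : ℕ → Flags

namespace Scan

variable {Q S : Type*} (M : Scan Q S)

/-- The direction of the scan in column `x`. -/
def isUp (x : ℕ) : Bool := decide (x % 2 = 1)

lemma isUp_succ (x : ℕ) : isUp (x + 1) = !isUp x := by
  unfold isUp
  rcases Nat.mod_two_eq_zero_or_one x with h | h <;> simp [h, Nat.add_mod]

@[simp] lemma isUp_zero : isUp 0 = false := rfl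

/-- Row `k` is the first one of a column that is scanned in the direction `up`. -/
def IsFirst (up : Bool) (k : ℕ) : Prop := if up then k = 0 else k + 1 = M.w

instance (up : Bool) (k : ℕ) : Decidable (M.IsFirst up k) := by
  unfold IsFirst; infer_instance

/-- The given states and symbols are a run of the machine, and the states determine the flags. -/
structure Run : Prop where
  two_le : 2 ≤ M.w
  w_lt : M.w < M.n
  flags_q : ∀ x y, 1 ≤ x → y < M.w → M.flags (M.q x y) = M.φ x
  s_succ : ∀ x y, 1 ≤ x → y < M.w → M.s (x + 1) y = M.out (isUp x) y (M.q x y) (M.s x y)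
  q_up : ∀ x y, 1 ≤ x → isUp x = true → y + 1 < M.w →
    M.q x (y + 1) = M.next true y (M.q x y) (M.s x y)
  q_up_last : ∀ x y, 1 ≤ x → isUp x = true → y + 1 = M.w →
    M.q (x + 1) y = M.next true y (M.q x y) (M.s x y)
  q_down : ∀ x y, 1 ≤ x → isUp x = false → y + 1 < M.w →
    M.q x y = M.next false (y + 1) (M.q x (y + 1)) (M.s x (y + 1))
  q_down_last : ∀ x, 1 ≤ x → isUp x = false →
    M.q (x + 1) 0 = M.next false 0 (M.q x 0) (M.s x 0)
  stop_iff : ∀ x, 1 ≤ x → x ≤ M.n → (M.φ x 2 = true ↔ x = M.n)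
  diag_iff : ∀ x, x < M.n → (M.φ x 3 = true ↔ x = M.w)

/-- Flag 3 marks column `w`, where the strong glue starts the staircase at `(w, w)`. -/
def colGlue (fl : Flags) : SquareGlue Q S := if fl 3 then .diagCol fl else .col fl

/-- The glue on the east side of a band tile, where `q` and `s` are the new state and symbol. -/
def eastGlue (up : Bool) (k : ℕ) (q : Q) (s : S) : Option (SquareGlue Q S) :=
  -- The last row of this column is the first row of the next. Flag 2 of the new state says that the
  -- next column is number `n`; leaving out the glue there ends the scan.
  if M.IsFirst (!up) k then (if M.flags q 2 then none else some (.turn (!up) s q))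
  else some (.row k (!up) s)

def side : SquareTile Q S → Dir → Option (SquareGlue Q S)
  | .seed k, .north => some (if k + 1 = M.w then colGlue (M.φ 0) else .seed k)
  | .seed k, .south => if k = 0 then none else some (.seed (k - 1))
  | .seed k, .east => some (if k = 0 then .turn true (M.s 1 0) (M.q 1 0) else .row k true (M.s 1 k))
  | .seed _, .west => none
  | .band up k q s, .west => some (if M.IsFirst up k then .turn up s q else .row k up s)
  | .band up k q s, .east => M.eastGlue up k (M.next up k q s) (M.out up k q s)
  | .band up k q s, .north => some (if k + 1 = M.w then colGlue (M.flags q) else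
      if up then .lift (k + 1) (M.next up k q s) else .drop k q)
  | .band up k q s, .south => if k = 0 then none else
      some (if up then .lift k q else .drop (k - 1) (M.next up k q s))
  | .above fl _, .north => some (.col fl)
  | .above fl _, .south => some (.col fl)
  | .above _ b, .east => some (.rowW b)
  | .above _ b, .west => some (.rowW b)
  | .diag fl, .north => some (.col fl)
  | .diag fl, .south => some (.diagCol fl)
  | .diag fl, .east => some (.diagRow (fl 1))
  | .diag fl, .west => some (.rowW (fl 1))
  | .sub fl _, .north => some (.diagCol fl)
  | .sub fl _, .south => some (.col fl)
  | .sub _ b, .east => some (.rowE b)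
  | .sub _ b, .west => some (.diagRow b)
  | .below fl _, .north => some (.col fl)
  | .below fl _, .south => some (.col fl)
  | .below _ b, .east => some (.rowE b)
  | .below _ b, .west => some (.rowE b)

/-- The tile at the location `(x, y)`. -/
def tileAt (x y : ℕ) : SquareTile Q S :=
  if y < M.w then (if x = 0 then .seed y else .band (isUp x) y (M.q x y) (M.s x y))
  else if x < y then .above (M.φ x) (M.φ y 1)
  else if x = y then .diag (M.φ x)
  else if x = y + 1 then .sub (M.φ x) (M.φ y 1)
  else .below (M.φ x) (M.φ y 1)

/-- The glue between the locations `(x, y)` and `(x + 1, y)`. -/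
def vGlue (x y : ℕ) : Option (SquareGlue Q S) :=
  if y < M.w then
    if M.IsFirst (isUp (x + 1)) y then
      if x + 1 = M.n then none else some (.turn (isUp (x + 1)) (M.s (x + 1) y) (M.q (x + 1) y))
    else some (.row y (isUp (x + 1)) (M.s (x + 1) y))
  else some (if x < y then .rowW (M.φ y 1) else if x = y then .diagRow (M.φ y 1)
    else .rowE (M.φ y 1))

/-- The glue between the locations `(x, y)` and `(x, y + 1)`. -/
def hGlue (x y : ℕ) : SquareGlue Q S :=
  if y + 1 < M.w then
    if isUp x then .lift (y + 1) (M.q x (y + 1)) else if x = 0 then .seed y else .drop y (M.q x y)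
  else if x = y + 1 then .diagCol (M.φ x) else .col (M.φ x)

def flow : SquareGlue Q S → Dir
  | .seed _ => .south
  | .turn _ _ _ => .east
  | .row _ _ _ => .east
  | .lift _ _ => .north
  | .drop _ _ => .south
  | .col _ => .north
  | .diagCol _ => .north
  | .rowE _ => .east
  | .diagRow _ => .east
  | .rowW _ => .west

/-- A tile with a strong input has no other input; the remaining tiles, except the seed itself, need
two weak ones from different neighbours. Thus only strong glues could lead out of the square, and of
these only `turn` reaches its border, where flag 2 suppresses it. -/
def strong : SquareGlue Q S → Bool
  | .seed _ => true
  | .turn _ _ _ => true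
  | .diagCol _ => true
  | _ => false

variable {M}

/-- With the three lemmas on the other sides, this shows that abutting tiles of the layout carry the
same glue, so all later arguments can read glues off `vGlue` and `hGlue`. -/
lemma side_west {x y : ℕ} (hx : x + 1 < M.n) :
    M.side (M.tileAt (x + 1) y) .west = M.vGlue x y := by
  unfold tileAt vGlue
  by_cases hy : y < M.w
  · have : x + 1 ≠ M.n := by omega
    simp only [hy, if_true, Nat.succ_ne_zero, if_false, side, this]
    split_ifs <;> rfl
  · simp only [hy, if_false]
    split_ifs <;> first | rfl | omega | (subst_vars; rfl)

namespace Run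

variable (hM : M.Run)
include hM

lemma side_north {x y : ℕ} (hx : x < M.n) :
    M.side (M.tileAt x y) .north = some (M.hGlue x y) := by
  have h2 := hM.two_le
  have hw := hM.w_lt
  have hd := hM.diag_iff x hx
  unfold tileAt hGlue
  by_cases hy : y < M.w
  · by_cases hx0 : x = 0
    · subst hx0
      by_cases hy' : y + 1 = M.w
      · have : ¬ 0 = M.w := by omega
        simp [hy, side, hy', colGlue, hd, this]
      · have : y + 1 < M.w := by omega
        simp [hy, side, hy', this]
    · by_cases hy' : y + 1 = M.w
      · simp only [hy, if_true, hx0, if_false, side, hy', lt_irrefl, colGlue,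
          hM.flags_q x y (by omega) hy, hd]
      · have h3 : y + 1 < M.w := by omega
        cases hu : isUp x
        · simp [hy, side, hy', h3, hx0]
        · simp [hy, side, hy', h3, hx0, hM.q_up x y (by omega) hu h3]
  · have h3 : ¬ (y + 1 < M.w) := by omega
    simp only [hy, h3, if_false]
    split_ifs <;> first | rfl | omega

lemma side_south (x y : ℕ) :
    M.side (M.tileAt x (y + 1)) .south = some (M.hGlue x y) := by
  unfold tileAt hGlue
  by_cases hy' : y + 1 < M.w
  · by_cases hx0 : x = 0
    · subst hx0
      simp [hy', side]
    · cases hu : isUp x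
      · simp [hy', side, hx0, hM.q_down x y (by omega) hu hy']
      · simp [hy', side, hx0]
  · simp only [hy', if_false]
    split_ifs <;> first | rfl | omega

lemma side_east {x y : ℕ} (hx : x < M.n) :
    M.side (M.tileAt x y) .east = M.vGlue x y := by
  have h2 := hM.two_le
  have hw := hM.w_lt
  unfold tileAt vGlue
  by_cases hy : y < M.w
  · by_cases hx0 : x = 0
    · subst hx0
      have h1 : 0 + 1 ≠ M.n := by omega
      simp only [hy, if_true, side, isUp_succ, isUp_zero, IsFirst, h1, if_false, Bool.not_false,
        if_true]
      split_ifs with h3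
      · subst h3; rfl
      · rfl
    · have hs := hM.s_succ x y (by omega) hy
      simp only [hy, if_true, hx0, if_false, side, eastGlue, isUp_succ, hs]
      by_cases hf : M.IsFirst (!isUp x) y
      · have hq : M.q (x + 1) y = M.next (isUp x) y (M.q x y) (M.s x y) := by
          cases hu : isUp x <;> simp only [hu, IsFirst, Bool.not_false, Bool.not_true, if_true] at hf
          · subst hf; exact hM.q_down_last x (by omega) hu
          · exact hM.q_up_last x y (by omega) hu (by simpa using hf)
        have hst := hM.stop_iff (x + 1) (by omega) (by omega)
        simp only [hf, if_true, ← hq, hM.flags_q (x + 1) y (by omega) hy, hst]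
      · simp only [hf, if_false]
  · simp only [hy, if_false]
    split_ifs <;> first | rfl | omega | (subst_vars; rfl)

end Run

lemma vGlue_eq_turn {x y : ℕ} {up : Bool} {s : S} {q : Q}
    (h : M.vGlue x y = some (.turn up s q)) :
    y < M.w ∧ x + 1 ≠ M.n ∧ M.IsFirst up y ∧ up = isUp (x + 1) ∧ s = M.s (x + 1) y ∧
      q = M.q (x + 1) y := by
  unfold vGlue at h
  split_ifs at h <;> simp_all

lemma vGlue_eq_row {x y k : ℕ} {up : Bool} {s : S} (h : M.vGlue x y = some (.row k up s)) :
    y < M.w ∧ ¬ M.IsFirst up y ∧ k = y ∧ up = isUp (x + 1) ∧ s = M.s (x + 1) y := by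
  unfold vGlue at h
  split_ifs at h <;> simp_all only [Option.some.injEq, SquareGlue.row.injEq, reduceCtorEq]
  obtain ⟨rfl, rfl, rfl⟩ := h
  simp_all

lemma vGlue_eq_rowE {x y : ℕ} {b : Bool} (h : M.vGlue x y = some (.rowE b)) :
    M.w ≤ y ∧ y < x ∧ b = M.φ y 1 := by
  unfold vGlue at h
  split_ifs at h <;> simp_all
  omega

lemma vGlue_eq_diagRow {x y : ℕ} {b : Bool} (h : M.vGlue x y = some (.diagRow b)) :
    M.w ≤ y ∧ x = y ∧ b = M.φ y 1 := by
  unfold vGlue at h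
  split_ifs at h <;> simp_all

lemma vGlue_eq_rowW {x y : ℕ} {b : Bool} (h : M.vGlue x y = some (.rowW b)) :
    M.w ≤ y ∧ x < y ∧ b = M.φ y 1 := by
  unfold vGlue at h
  split_ifs at h <;> simp_all

lemma hGlue_eq_lift {x y k : ℕ} {q : Q} (h : M.hGlue x y = .lift k q) :
    y + 1 < M.w ∧ isUp x = true ∧ k = y + 1 ∧ q = M.q x (y + 1) := by
  unfold hGlue at h
  split_ifs at h
  cases h
  simp_all

lemma hGlue_eq_seed {x y k : ℕ} (h : M.hGlue x y = .seed k) : y + 1 < M.w ∧ x = 0 ∧ k = y := by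
  unfold hGlue at h
  split_ifs at h
  simp_all

lemma hGlue_eq_drop {x y k : ℕ} {q : Q} (h : M.hGlue x y = .drop k q) :
    y + 1 < M.w ∧ isUp x = false ∧ k = y ∧ q = M.q x y := by
  unfold hGlue at h
  split_ifs at h
  cases h
  simp_all

lemma hGlue_eq_col {x y : ℕ} {fl : Flags} (h : M.hGlue x y = .col fl) :
    M.w ≤ y + 1 ∧ x ≠ y + 1 ∧ fl = M.φ x := by
  unfold hGlue at h
  split_ifs at h
  simp_all

lemma hGlue_eq_diagCol {x y : ℕ} {fl : Flags} (h : M.hGlue x y = .diagCol fl) :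
    M.w ≤ y + 1 ∧ x = y + 1 ∧ fl = M.φ x := by
  unfold hGlue at h
  split_ifs at h
  simp_all

@[simp] lemma flow_seed (k : ℕ) : flow (.seed k : SquareGlue Q S) = .south := rfl
@[simp] lemma flow_turn (up : Bool) (s : S) (q : Q) : flow (.turn up s q) = .east := rfl
@[simp] lemma flow_row (k : ℕ) (up : Bool) (s : S) :
    flow (.row k up s : SquareGlue Q S) = .east := rfl
@[simp] lemma flow_lift (k : ℕ) (q : Q) : flow (.lift k q : SquareGlue Q S) = .north := rfl
@[simp] lemma flow_drop (k : ℕ) (q : Q) : flow (.drop k q : SquareGlue Q S) = .south := rfl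
@[simp] lemma flow_col (fl : Flags) : flow (.col fl : SquareGlue Q S) = .north := rfl
@[simp] lemma flow_diagCol (fl : Flags) : flow (.diagCol fl : SquareGlue Q S) = .north := rfl
@[simp] lemma flow_rowE (b : Bool) : flow (.rowE b : SquareGlue Q S) = .east := rfl
@[simp] lemma flow_diagRow (b : Bool) : flow (.diagRow b : SquareGlue Q S) = .east := rfl
@[simp] lemma flow_rowW (b : Bool) : flow (.rowW b : SquareGlue Q S) = .west := rfl

@[simp] lemma flow_colGlue (fl : Flags) : flow (colGlue fl : SquareGlue Q S) = .north := by
  unfold colGlue; split_ifs <;> rfl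

/-! ### Order of growth and number of tile types. -/

section Blueprint

variable (M)

/-- The order of growth: the band in the order of the scan, then the rest of the square. -/
def rankAt (x y : ℕ) : ℕ :=
  if y < M.w then x * M.w + (if isUp x then y else M.w - 1 - y)
  -- Both expressions give `2 * y` on the diagonal; the first increases to the north and to the
  -- west, the second to the north and to the east.
  else M.n * M.w + (if x < y then 3 * y - x else x + y)

/-- The tiles of the system: those of the band carry the number of one of its rows. -/
def IsTile : SquareTile Q S → Prop
  | .seed k => k < M.w
  | .band _ k _ _ => k < M.w
  | _ => True

variable [Fintype Q] [Fintype S]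

open Classical in
noncomputable def names : Finset (SquareTile Q S) :=
  (Finset.range M.w).image .seed ∪
  (Finset.univ ×ˢ Finset.range M.w ×ˢ Finset.univ ×ˢ Finset.univ).image
    (fun t => .band t.1 t.2.1 t.2.2.1 t.2.2.2) ∪
  Finset.univ.image (fun t : Flags × Bool => .above t.1 t.2) ∪
  Finset.univ.image (fun t : Flags => .diag t) ∪
  Finset.univ.image (fun t : Flags × Bool => .sub t.1 t.2) ∪
  Finset.univ.image (fun t : Flags × Bool => .below t.1 t.2)

lemma mem_names {t : SquareTile Q S} : t ∈ M.names ↔ M.IsTile t := by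
  cases t <;> simp [names, IsTile]

/-- There are 16 values of the flags, whence 112 = 3 · 32 + 16; the factor 2 is the direction of the
scan. -/
lemma card_names_le :
    M.names.card ≤ (1 + 2 * (Fintype.card Q * Fintype.card S)) * M.w + 112 := by
  classical
  unfold names
  refine (Finset.card_union_le _ _).trans ?_
  refine (Nat.add_le_add ((Finset.card_union_le _ _).trans (Nat.add_le_add
    ((Finset.card_union_le _ _).trans (Nat.add_le_add ((Finset.card_union_le _ _).trans
    (Nat.add_le_add ((Finset.card_union_le _ _).trans (Nat.add_le_add Finset.card_image_le
    Finset.card_image_le)) Finset.card_image_le)) Finset.card_image_le)) Finset.card_image_le))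
    Finset.card_image_le).trans ?_
  simp only [Finset.card_range, Finset.card_product, Finset.card_univ, Fintype.card_bool,
    Fintype.card_prod, Fintype.card_fun, Fintype.card_fin]
  apply le_of_eq
  ring

noncomputable def blueprint : Blueprint (SquareGlue Q S) (SquareTile Q S) where
  flow := flow
  strong := strong
  side := M.side
  names := M.names
  layout := gridLayout M.n M.tileAt
  origin := ((0 : ℕ), ((M.w - 1 : ℕ) : ℤ))
  rank p := M.rankAt p.1.toNat p.2.toNat

end Blueprint

lemma rankAt_succ_lt {x y : ℕ} {g : SquareGlue Q S}
    (h : M.vGlue x y = some g) (hg : flow g = .east) : M.rankAt x y < M.rankAt (x + 1) y := by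
  unfold rankAt
  by_cases hy : y < M.w
  · simp only [hy, if_true, isUp_succ, Nat.add_mul, one_mul]
    split_ifs <;> omega
  · have : ¬ x < y := by
      intro hxy
      simp only [vGlue, hy, hxy, if_true, if_false, Option.some.injEq] at h
      subst h
      simp at hg
    simp only [hy, if_false]
    split_ifs <;> omega

lemma rankAt_east_lt {x y : ℕ} {g : SquareGlue Q S}
    (h : M.vGlue x y = some g) (hg : flow g = .west) : M.rankAt (x + 1) y < M.rankAt x y := by
  unfold vGlue at h
  split_ifs at h <;> simp only [Option.some.injEq] at h <;> subst h <;> simp at hg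
  unfold rankAt
  simp only [*, if_true, if_false]
  split_ifs <;> omega

lemma rankAt_lt_of_north {x y : ℕ} {g : SquareGlue Q S} (hx : x < M.n)
    (h : M.hGlue x y = g) (hg : flow g = .north) : M.rankAt x y < M.rankAt x (y + 1) := by
  unfold rankAt
  by_cases hy : y + 1 < M.w
  · have hu : isUp x = true := by
      by_contra hu
      simp only [hGlue, hy, hu, if_true] at h
      subst h
      split_ifs at hg <;> simp_all
    simp [hy, hu, show y < M.w by omega]
  · have h1 : (x + 1) * M.w ≤ M.n * M.w := Nat.mul_le_mul_right _ hx
    rw [Nat.add_mul, one_mul] at h1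
    simp only [hy, if_false]
    split_ifs <;> omega

lemma rankAt_lt_of_south {x y : ℕ} {g : SquareGlue Q S}
    (h : M.hGlue x y = g) (hg : flow g = .south) : M.rankAt x (y + 1) < M.rankAt x y := by
  unfold hGlue at h
  unfold rankAt
  by_cases hy : y + 1 < M.w
  · have hu : isUp x = false := by
      by_contra hu
      simp only [Bool.not_eq_false] at hu
      simp only [hy, hu, if_true] at h
      subst h
      simp at hg
    simp [hy, hu, show y < M.w by omega]
    omega
  · simp only [hy, if_false] at h
    subst h
    split_ifs at hg <;> simp at hg

/-! ### Validity of the blueprint of a run. -/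

namespace Run

variable [Fintype Q] [Fintype S] (hM : M.Run)

lemma sum_seed (k : ℕ) : ∑ d, M.blueprint.inputStr (.seed k) d = if k + 1 = M.w then 0 else 2 := by
  rw [Dir.sum_univ]
  rcases Nat.eq_zero_or_pos k with rfl | h0
  · by_cases h : 0 + 1 = M.w <;>
    simp [Blueprint.inputStr, blueprint, side, Blueprint.str, strong, Dir.opp, h]
  · by_cases h : k + 1 = M.w <;>
    simp [Blueprint.inputStr, blueprint, side, Blueprint.str, strong, Dir.opp, h, h0.ne']

include hM

lemma sum_band {up : Bool} {k : ℕ} {q : Q} {s : S} :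
    ∑ d, M.blueprint.inputStr (.band up k q s) d = 2 := by
  have h2 := hM.two_le
  rw [Dir.sum_univ]
  have he : M.blueprint.inputStr (.band up k q s) .east = 0 := by
    simp only [Blueprint.inputStr, blueprint, side, eastGlue]
    split_ifs <;> simp [Dir.opp]
  rw [he]
  cases up
  · by_cases h : k + 1 = M.w
    · have : k ≠ 0 := by omega
      simp [Blueprint.inputStr, blueprint, side, Blueprint.str, IsFirst, h, Dir.opp, strong,
        this]
    · rcases Nat.eq_zero_or_pos k with rfl | h0
      · have h1 : 1 ≠ M.w := by omega
        simp [Blueprint.inputStr, blueprint, side, Blueprint.str, IsFirst, h1, Dir.opp, strong]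
      have h0 : k ≠ 0 := by omega
      simp [Blueprint.inputStr, blueprint, side, Blueprint.str, IsFirst, h, Dir.opp, strong,
        h0]
  · by_cases h0 : k = 0
    · have : 1 ≠ M.w := by omega
      simp [Blueprint.inputStr, blueprint, side, Blueprint.str, IsFirst, h0, Dir.opp, strong,
        this]
    · by_cases h : k + 1 = M.w <;>
      simp [Blueprint.inputStr, blueprint, side, Blueprint.str, IsFirst, h, Dir.opp, strong,
        h0]

lemma sum_inputStr {t : SquareTile Q S} (ht : ∀ k, t ≠ .seed k) :
    ∑ d, M.blueprint.inputStr t d = 2 := by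
  cases t with
  | seed k => exact absurd rfl (ht k)
  | band up k q s => exact hM.sum_band
  | _ =>
    rw [Dir.sum_univ]
    simp [Blueprint.inputStr, blueprint, side, Blueprint.str, Dir.opp, strong]

lemma match_west {t : SquareTile Q S} {p : ℤ × ℤ} (h : M.blueprint.InputsMatch t p)
    {g : SquareGlue Q S} (h1 : M.side t .west = some g) (h2 : flow g = .east) :
    ∃ x y : ℕ, x < M.n ∧ y < M.n ∧ p = (((x + 1 : ℕ) : ℤ), (y : ℤ)) ∧ M.vGlue x y = some g := by
  obtain ⟨u, hu, hg⟩ := h .west g ⟨h1, h2⟩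
  obtain ⟨x, y, hx, hy, hp, rfl⟩ := gridLayout_west hu
  exact ⟨x, y, hx, hy, hp, (hM.side_east hx).symm.trans hg⟩

lemma match_south {t : SquareTile Q S} {p : ℤ × ℤ} (h : M.blueprint.InputsMatch t p)
    {g : SquareGlue Q S} (h1 : M.side t .south = some g) (h2 : flow g = .north) :
    ∃ x y : ℕ, x < M.n ∧ y < M.n ∧ p = ((x : ℤ), ((y + 1 : ℕ) : ℤ)) ∧ M.hGlue x y = g := by
  obtain ⟨u, hu, hg⟩ := h .south g ⟨h1, h2⟩
  obtain ⟨x, y, hx, hy, hp, rfl⟩ := gridLayout_south hu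
  exact ⟨x, y, hx, hy, hp, Option.some_injective _ ((hM.side_north hx).symm.trans hg)⟩

lemma match_north {t : SquareTile Q S} {p : ℤ × ℤ} (h : M.blueprint.InputsMatch t p)
    {g : SquareGlue Q S} (h1 : M.side t .north = some g) (h2 : flow g = .south) :
    ∃ x y : ℕ, x < M.n ∧ y + 1 < M.n ∧ p = ((x : ℤ), (y : ℤ)) ∧ M.hGlue x y = g := by
  obtain ⟨u, hu, hg⟩ := h .north g ⟨h1, h2⟩
  obtain ⟨x, y, hx, hy, hp, rfl⟩ := gridLayout_north hu
  have hw := hM.two_le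
  -- Tiles of row 0 have no glue on their south side, so nothing grows below the square.
  rcases y with _ | y
  · exfalso
    have h3 : M.side (M.tileAt x 0) .south = none := by
      unfold tileAt
      rw [if_pos (by omega)]
      split_ifs <;> simp [side]
    have := h3.symm.trans hg
    simp at this
  · exact ⟨x, y, hx, hy, by simp [hp],
      Option.some_injective _ ((hM.side_south x y).symm.trans hg)⟩

/-- Each glue reveals in which part of the square it lies and what the tile must know: a `turn` glue
carries state and symbol together, while otherwise the symbol comes from the west and the state
along the column. Two weak inputs also confine the location to the square, since each provider
bounds a coordinate. -/
lemma layout_of_match {t : SquareTile Q S} (ht : M.IsTile t) {p : ℤ × ℤ}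
    (hsum : ∑ d, M.blueprint.inputStr t d = 2) (h : M.blueprint.InputsMatch t p) :
    M.blueprint.layout p = some t := by
  have h2 := hM.two_le
  have hwn := hM.w_lt
  have key : ∀ x y : ℕ, x < M.n → y < M.n → p = ((x : ℤ), (y : ℤ)) → M.tileAt x y = t →
      M.blueprint.layout p = some t := by
    rintro x y hx hy rfl rfl
    exact gridLayout_coe hx hy
  cases t with
  | seed k =>
    have hk : k + 1 ≠ M.w := fun hk => by simp [sum_seed, hk] at hsum
    obtain ⟨x, y, hx, hy, hp, hg⟩ := hM.match_north h (g := .seed k) (by simp [side, hk]) rfl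
    obtain ⟨hy', rfl, rfl⟩ := hGlue_eq_seed hg
    refine key 0 k hx (by omega) hp ?_
    simp [tileAt, show k < M.w by omega]
  | band up k q s =>
    by_cases hf : M.IsFirst up k
    · obtain ⟨x, y, hx, hy, hp, hg⟩ := hM.match_west h (g := .turn up s q) (by simp [side, hf]) rfl
      obtain ⟨hy', hx', hf', rfl, rfl, rfl⟩ := vGlue_eq_turn hg
      -- A `turn` glue carries no row number, but the direction of the scan determines the first
      -- row.
      have : k = y := by
        revert hf hf'
        unfold IsFirst
        split_ifs <;> omega
      subst this
      exact key (x + 1) k (by omega) hy hp (by simp [tileAt, hy'])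
    · obtain ⟨x, y, hx, hy, hp, hg⟩ := hM.match_west h (g := .row k up s) (by simp [side, hf]) rfl
      obtain ⟨hy', hf', rfl, rfl, rfl⟩ := vGlue_eq_row hg
      cases hu : isUp (x + 1) <;> rw [hu] at hf h key
      · have hk : k + 1 ≠ M.w := by simpa [IsFirst] using hf
        obtain ⟨x', y', hx1, hy1, hp', hg'⟩ := hM.match_north h (g := .drop k q)
          (by simp [side, hk]) rfl
        obtain ⟨-, -, rfl, rfl⟩ := hGlue_eq_drop hg'
        have hxx : x' = x + 1 := by
          have := congrArg Prod.fst (hp.symm.trans hp')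
          simp only [Nat.cast_inj] at this
          exact this.symm
        subst hxx
        exact key (x + 1) k hx1 hy hp (by simp [tileAt, hy', hu])
      · have hk : k ≠ 0 := by simpa [IsFirst] using hf
        obtain ⟨x', y', hx1, hy1, hp', hg'⟩ := hM.match_south h (g := .lift k q)
          (by simp [side, hk]) rfl
        obtain ⟨-, -, rfl, rfl⟩ := hGlue_eq_lift hg'
        have hxx : x' = x + 1 := by
          have := congrArg Prod.fst (hp.symm.trans hp')
          simp only [Nat.cast_inj] at this
          exact this.symm
        subst hxx
        exact key (x + 1) (y' + 1) hx1 hy hp (by simp [tileAt, hy', hu])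
  | above fl b =>
    obtain ⟨x, y, hx, hy, rfl, hg⟩ := hM.match_south h (g := .col fl) rfl rfl
    obtain ⟨hy', hxy, rfl⟩ := hGlue_eq_col hg
    obtain ⟨u, hu, hg⟩ := h .east (.rowW b) ⟨rfl, rfl⟩
    obtain ⟨x', y', hx1, hy1, hp, rfl⟩ := gridLayout_east hu
    simp only [Prod.mk.injEq, Nat.cast_inj] at hp
    obtain ⟨hxx, rfl⟩ := hp
    obtain rfl : x' = x + 1 := by omega
    obtain ⟨h3, h4, rfl⟩ := vGlue_eq_rowW ((M.side_west hx1).symm.trans hg)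
    refine key x (y + 1) hx hy1 rfl ?_
    simp [tileAt, show ¬ (y + 1 < M.w) by omega, h4]
  | diag fl =>
    obtain ⟨x, y, hx, hy, rfl, hg⟩ := hM.match_south h (g := .diagCol fl) rfl rfl
    obtain ⟨hy', rfl, rfl⟩ := hGlue_eq_diagCol hg
    refine key (y + 1) (y + 1) hx hx rfl ?_
    simp [tileAt, show ¬ (y + 1 < M.w) by omega]
  | sub fl b =>
    obtain ⟨x, y, hx, hy, rfl, hg⟩ := hM.match_south h (g := .col fl) rfl rfl
    obtain ⟨hy', hxy, rfl⟩ := hGlue_eq_col hg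
    obtain ⟨x', y', hx1, hy1, hp, hg⟩ := hM.match_west h (g := .diagRow b) rfl rfl
    simp only [Prod.mk.injEq, Nat.cast_inj] at hp
    obtain ⟨rfl, rfl⟩ := hp
    obtain ⟨h3, h4, rfl⟩ := vGlue_eq_diagRow hg
    refine key (x' + 1) (y + 1) hx hy1 rfl ?_
    simp [tileAt, show ¬ (y + 1 < M.w) by omega, h4]
  | below fl b =>
    obtain ⟨x, y, hx, hy, rfl, hg⟩ := hM.match_south h (g := .col fl) rfl rfl
    obtain ⟨hy', hxy, rfl⟩ := hGlue_eq_col hg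
    obtain ⟨x', y', hx1, hy1, hp, hg⟩ := hM.match_west h (g := .rowE b) rfl rfl
    simp only [Prod.mk.injEq, Nat.cast_inj] at hp
    obtain ⟨rfl, rfl⟩ := hp
    obtain ⟨h3, h4, rfl⟩ := vGlue_eq_rowE hg
    refine key (x' + 1) (y + 1) hx hy1 rfl ?_
    simp [tileAt, show ¬ (y + 1 < M.w) by omega, show ¬ (x' + 1 < y + 1) by omega,
      show x' ≠ y + 1 by omega, show x' ≠ y by omega]

/-- The neighbour that provides an input in the layout. -/
lemma exists_neighbor {x y : ℕ} (hx : x < M.n) (hy : y < M.n) {d : Dir} {g : SquareGlue Q S}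
    (h : M.blueprint.IsInput (M.tileAt x y) d g) :
    (∃ x', x = x' + 1 ∧ d = .west ∧ M.vGlue x' y = some g ∧ flow g = .east) ∨
    (∃ y', y = y' + 1 ∧ d = .south ∧ M.hGlue x y' = g ∧ flow g = .north) ∨
    (x + 1 < M.n ∧ d = .east ∧ M.vGlue x y = some g ∧ flow g = .west) ∨
    (y + 1 < M.n ∧ d = .north ∧ M.hGlue x y = g ∧ flow g = .south) := by
  have h2 := hM.two_le
  have hwn := hM.w_lt
  obtain ⟨h1, hfl⟩ := h
  simp only [blueprint] at h1 hfl
  cases d with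
  | west =>
    left
    rcases x with _ | x
    · exfalso
      unfold tileAt at h1
      split_ifs at h1 <;> simp only [side, Option.some.injEq, reduceCtorEq] at h1 <;>
        first | omega | (subst h1; simp [Dir.opp] at hfl)
    · exact ⟨x, rfl, rfl, (M.side_west hx).symm.trans h1, hfl⟩
  | south =>
    right; left
    rcases y with _ | y
    · exfalso
      unfold tileAt at h1
      rw [if_pos (by omega)] at h1
      split_ifs at h1 <;> simp [side] at h1
    · exact ⟨y, rfl, rfl, Option.some_injective _ ((hM.side_south x y).symm.trans h1), hfl⟩
  | east =>
    right; right; left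
    have hv := (hM.side_east hx).symm.trans h1
    refine ⟨?_, rfl, hv, hfl⟩
    unfold vGlue at hv
    split_ifs at hv <;> simp only [Option.some.injEq] at hv <;> subst hv <;>
      first | omega | simp [Dir.opp] at hfl
  | north =>
    right; right; right
    have hv := Option.some_injective _ ((hM.side_north hx).symm.trans h1)
    refine ⟨?_, rfl, hv, hfl⟩
    unfold hGlue at hv
    split_ifs at hv <;> subst hv <;> first | omega | simp [Dir.opp] at hfl

lemma valid : M.blueprint.Valid where
  flow_axis := by
    intro t _ d g h
    simp only [blueprint] at h ⊢
    cases t <;> cases d <;> simp only [side, eastGlue] at h <;> (try split_ifs at h) <;>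
      cases h <;> simp [Dir.opp]
  input_le := by
    intro t _
    cases t with
    | seed k => rw [sum_seed]; split_ifs <;> simp
    | _ => exact (hM.sum_inputStr (by simp)).le
  unique t ht p hsum h := hM.layout_of_match (M.mem_names.1 ht) hsum h
  layout_mem := by
    intro p t h
    obtain ⟨x, y, hx, hy, -, rfl⟩ := gridLayout_eq_some.1 h
    refine M.mem_names.2 ?_
    unfold tileAt
    split_ifs <;> simp_all [IsTile]
  layout_match := by
    intro p t h d g hg
    obtain ⟨x, y, hx, hy, rfl, rfl⟩ := gridLayout_eq_some.1 h
    rcases hM.exists_neighbor hx hy hg with ⟨x, rfl, rfl, h1, -⟩ | ⟨y, rfl, rfl, h1, -⟩ |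
      ⟨hx', rfl, h1, -⟩ | ⟨hy', rfl, h1, -⟩
    · have hx' : x < M.n := by omega
      exact ⟨_, gridLayout_add_west hx' hy, (hM.side_east hx').trans h1⟩
    · exact ⟨_, gridLayout_add_south hx (by omega), (hM.side_north hx).trans (congrArg some h1)⟩
    · exact ⟨_, gridLayout_add_east hx' hy, (M.side_west hx').trans h1⟩
    · exact ⟨_, gridLayout_add_north hx hy', (hM.side_south x y).trans (congrArg some h1)⟩
  layout_rank := by
    intro p t d g h hg
    obtain ⟨x, y, hx, hy, rfl, rfl⟩ := gridLayout_eq_some.1 h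
    rcases hM.exists_neighbor hx hy hg with ⟨x, rfl, rfl, h1, h2⟩ | ⟨y, rfl, rfl, h1, h2⟩ |
      ⟨hx', rfl, h1, h2⟩ | ⟨hy', rfl, h1, h2⟩
    · simpa [blueprint, Dir.vec] using rankAt_succ_lt h1 h2
    · simpa [blueprint, Dir.vec] using rankAt_lt_of_north hx h1 h2
    · simpa [blueprint, Dir.vec] using rankAt_east_lt h1 h2
    · simpa [blueprint, Dir.vec] using rankAt_lt_of_south h1 h2
  layout_strength := by
    intro p t h hp
    obtain ⟨x, y, hx, hy, rfl, rfl⟩ := gridLayout_eq_some.1 h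
    by_cases h0 : y < M.w ∧ x = 0
    · obtain ⟨h0, rfl⟩ := h0
      have : M.tileAt 0 y = .seed y := by simp [tileAt, h0]
      rw [this, sum_seed, if_neg]
      intro hy'
      apply hp
      simp [blueprint, ← hy']
    · refine hM.sum_inputStr ?_
      unfold tileAt
      split_ifs <;> simp_all
  layout_origin := by
    have h2 := hM.two_le
    have hwn := hM.w_lt
    refine ⟨.seed (M.w - 1), ?_, ?_⟩
    · refine (gridLayout_coe (f := M.tileAt) (x := 0) (y := M.w - 1) (by omega)
        (by omega)).trans ?_
      simp [tileAt, show M.w - 1 < M.w by omega]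
    · rw [sum_seed, if_pos (by omega)]

/-- The system of a run weakly self-assembles the stripes that the flags describe. -/
theorem exists_system {A C : Type*} [Nonempty A] [Countable Q] [Countable S] (black white : C)
    (i j : ℕ) (hi : ∀ x < M.n, (M.φ x 0 = true ↔ x % i = 0))
    (hj : ∀ x < M.n, (M.φ x 1 = true ↔ x % j = 0)) :
    ∃ (𝒯 : TAS A) (color : TileType A → C), 𝒯.temp = 2 ∧ 𝒯.seed.dom.ncard = 1 ∧
      𝒯.tiles.card ≤ (1 + 2 * (Fintype.card Q * Fintype.card S)) * M.w + 112 ∧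
      𝒯.WeaklySelfAssembles color {black, white} (stripes black white M.n i j) := by
  let isBlack : SquareTile Q S → Prop
    | .seed _ => True
    | .band _ k q _ => M.flags q 0 = true ∨ k % j = 0
    | .above fl b => fl 0 = true ∨ b = true
    | .diag fl => fl 0 = true ∨ fl 1 = true
    | .sub fl b => fl 0 = true ∨ b = true
    | .below fl b => fl 0 = true ∨ b = true
  obtain ⟨𝒯, color, h1, h2, h3, h4⟩ :=
    hM.valid.exists_system (A := A) black white M.n i j isBlack (fun p => gridLayout_ne_none) (by
      intro x y t h
      obtain ⟨x', y', hx, hy, h1, rfl⟩ := gridLayout_eq_some.1 h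
      simp only [Prod.mk.injEq, Nat.cast_inj] at h1
      obtain ⟨rfl, rfl⟩ := h1
      rw [← hi x hx, ← hj y hy]
      unfold tileAt
      split_ifs with h1 h2 h3 h4
      -- Column 0 is black for every `i`, so all tiles of the seed column are black.
      · subst h2
        simpa [isBlack] using Or.inl ((hi 0 hx).2 (Nat.zero_mod i))
      · simp [isBlack, hM.flags_q x y (by omega) h1, hj y hy]
      · rfl
      · simp [isBlack, h4]
      · rfl
      · rfl)
  exact ⟨𝒯, color, h1, h2, h3.trans M.card_names_le, h4⟩

end Run
end Scan
-- A counter modulo `m` as a scanning machine.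
/-- The state of a counter modulo `m`. In an upward scan, `carry` is the carry of the addition of
`2`, and `eqM`, `eqSucc` tell whether the sum agrees so far with `m` and with `m + 1`. In a downward
scan they tell it for the whole sum, and `eqPred` tells whether the reduced value agrees so far with
`m - 1`. The value of the current column is `0` if `zero` holds. -/
structure CounterState where
  carry : Fin 3
  eqM : Bool
  eqSucc : Bool
  eqPred : Bool
  zero : Bool
deriving DecidableEq, Fintype

namespace Counter

/-- Going up writes the unreduced sum. Going down replaces it by its residue: 0 if the sum is `m`,
`1 % m` if it is `m + 1`. -/
def out (m : ℕ) (up : Bool) (k : ℕ) (q : CounterState) (b : Bool) : Bool :=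
  if up then decide ((b.toNat + q.carry) % 2 = 1)
  else if q.eqM then false else if q.eqSucc then (1 % m).testBit k else b

def next (w m : ℕ) (up : Bool) (k : ℕ) (q : CounterState) (b : Bool) : CounterState :=
  let o := out m up k q b
  if up then
    let e₀ := q.eqM && (o == m.testBit k)
    let e₁ := q.eqSucc && (o == (m + 1).testBit k)
    -- At the top both comparisons are complete. The residue is 0 if the sum is `m`, or if it is `m
    -- + 1` and `m = 1`; `eqPred` starts as true for the comparison from the top bit down.
    if k + 1 = w then ⟨0, e₀, e₁, true, e₀ || (e₁ && decide (1 % m = 0))⟩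
    else ⟨Fin.ofNat 3 ((b.toNat + q.carry) / 2), e₀, e₁, q.eqPred, q.zero⟩
  else
    let e := q.eqPred && (o == (m - 1).testBit k)
    -- The next addition of 2 starts as a carry 2 into bit 0. The next column has value 0 exactly if
    -- this one has value `m - 1`.
    if k = 0 then ⟨2, true, true, false, e⟩ else ⟨q.carry, q.eqM, q.eqSucc, e, q.zero⟩

/-- The value of the counter with initial value `a` in column `x`. -/
def value (m a x : ℕ) : ℕ := (x + a) % m

/-- An upward column reads the reduced value of the previous column, a downward one the unreduced
sum written there. -/
def symbol (m a x y : ℕ) : Bool :=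
  if Scan.isUp x then (value m a (x - 1)).testBit y else (value m a (x - 2) + 2).testBit y

/-- The carry into bit `y` when 2 is added to `v`. -/
def carryAt (v y : ℕ) : ℕ := (v + 2) / 2 ^ y - v / 2 ^ y

def state (m a x y : ℕ) : CounterState :=
  if Scan.isUp x then
    ⟨Fin.ofNat 3 (carryAt (value m a (x - 1)) y),
      decide ((value m a (x - 1) + 2) % 2 ^ y = m % 2 ^ y),
      decide ((value m a (x - 1) + 2) % 2 ^ y = (m + 1) % 2 ^ y), false,
      decide (value m a x = 0)⟩
  else
    ⟨0, decide (value m a (x - 2) + 2 = m), decide (value m a (x - 2) + 2 = m + 1),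
      decide (value m a x / 2 ^ (y + 1) = (m - 1) / 2 ^ (y + 1)), decide (value m a x = 0)⟩

/-- One step of the comparison from the low bits, used going up. -/
lemma mod_two_pow_succ_eq_iff (u v k : ℕ) :
    u % 2 ^ (k + 1) = v % 2 ^ (k + 1) ↔ u % 2 ^ k = v % 2 ^ k ∧ u.testBit k = v.testBit k := by
  rw [pow_succ, Nat.mod_mul, Nat.mod_mul, Nat.testBit_eq_decide_div_mod_eq,
    Nat.testBit_eq_decide_div_mod_eq, decide_eq_decide]
  have h0 : 0 < 2 ^ k := by positivity
  have h1 := Nat.mod_lt u h0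
  have h2 := Nat.mod_lt v h0
  rcases Nat.mod_two_eq_zero_or_one (u / 2 ^ k) with h | h <;>
    rcases Nat.mod_two_eq_zero_or_one (v / 2 ^ k) with h' | h' <;> rw [h, h'] <;> omega

/-- One step of the comparison from the high bits, used going down. -/
lemma div_two_pow_eq_iff (u v k : ℕ) :
    u / 2 ^ k = v / 2 ^ k ↔
      u / 2 ^ (k + 1) = v / 2 ^ (k + 1) ∧ u.testBit k = v.testBit k := by
  rw [pow_succ, ← Nat.div_div_eq_div_mul, ← Nat.div_div_eq_div_mul,
    Nat.testBit_eq_decide_div_mod_eq, Nat.testBit_eq_decide_div_mod_eq, decide_eq_decide]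
  omega

lemma div_le_add_two_div (v y : ℕ) : v / 2 ^ y ≤ (v + 2) / 2 ^ y :=
  Nat.div_le_div_right (by omega)

lemma carryAt_succ (v y : ℕ) :
    carryAt v (y + 1) = ((v.testBit y).toNat + carryAt v y) / 2 := by
  have h := div_le_add_two_div v y
  unfold carryAt
  rw [pow_succ, ← Nat.div_div_eq_div_mul, ← Nat.div_div_eq_div_mul, Nat.toNat_testBit]
  omega

lemma carryAt_lt (v y : ℕ) : carryAt v y < 3 := by
  induction y with
  | zero => simp [carryAt]
  | succ y ih =>
    rw [carryAt_succ]
    have := Bool.toNat_le (v.testBit y)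
    omega

lemma testBit_add_two (v y : ℕ) :
    (v + 2).testBit y = decide (((v.testBit y).toNat + carryAt v y) % 2 = 1) := by
  have h := div_le_add_two_div v y
  rw [Nat.testBit_eq_decide_div_mod_eq, decide_eq_decide, Nat.toNat_testBit]
  unfold carryAt
  omega

variable {m a w : ℕ}

lemma value_lt (hm : 0 < m) (x : ℕ) : value m a x < m := Nat.mod_lt _ hm

/-- Since the value is below `m`, the sum is at most `m + 1`, and only two sums need reduction. -/
lemma value_add_two (hm : 0 < m) (x : ℕ) :
    value m a (x + 2) = if value m a x + 2 = m then 0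
      else if value m a x + 2 = m + 1 then 1 % m else value m a x + 2 := by
  have h : value m a (x + 2) = (value m a x + 2) % m := by
    simp [value, Nat.add_right_comm x 2 a]
  have hlt := value_lt (a := a) hm x
  rw [h]
  split_ifs with h1 h2
  · rw [h1, Nat.mod_self]
  · rw [h2, Nat.add_mod_left]
  · exact Nat.mod_eq_of_lt (by omega)

lemma value_succ_eq_zero (hm : 0 < m) (x : ℕ) : value m a (x + 1) = 0 ↔ value m a x = m - 1 := by
  have h : value m a (x + 1) = (value m a x + 1) % m := by
    simp [value, Nat.add_right_comm x 1 a]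
  have hlt := value_lt (a := a) hm x
  rw [h]
  constructor
  · intro h0
    by_contra hne
    rw [Nat.mod_eq_of_lt (by omega)] at h0
    omega
  · intro h0
    rw [h0, Nat.sub_add_cancel hm, Nat.mod_self]

lemma state_zero (x y : ℕ) : (state m a x y).zero = decide ((x + a) % m = 0) := by
  unfold state
  split_ifs <;> rfl

lemma out_up (z y : ℕ) (hz : Scan.isUp (z + 1) = true) :
    out m true y (state m a (z + 1) y) (symbol m a (z + 1) y) =
      (value m a z + 2).testBit y := by
  have hc : ((Fin.ofNat 3 (carryAt (value m a z) y) : Fin 3) : ℕ) = carryAt (value m a z) y :=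
    Nat.mod_eq_of_lt (carryAt_lt _ _)
  simp only [out, state, symbol, hz, if_true, Nat.add_sub_cancel, hc]
  rw [testBit_add_two]

lemma out_down (hm : 0 < m) (z y : ℕ) (hz : Scan.isUp (z + 2) = false) :
    out m false y (state m a (z + 2) y) (symbol m a (z + 2) y) =
      (value m a (z + 2)).testBit y := by
  simp only [out, state, symbol, hz, Bool.false_eq_true, if_false, Nat.add_sub_cancel,
    decide_eq_true_eq]
  rw [value_add_two hm]
  split_ifs <;> simp

lemma symbol_succ (hm : 0 < m) (x y : ℕ) (hx : 1 ≤ x) :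
    symbol m a (x + 1) y = out m (Scan.isUp x) y (state m a x y) (symbol m a x y) := by
  cases hu : Scan.isUp x
  · obtain ⟨z, rfl⟩ : ∃ z, x = z + 2 := by
      refine ⟨x - 2, ?_⟩
      have : x ≠ 1 := by rintro rfl; simp [Scan.isUp] at hu
      omega
    rw [out_down hm z y hu]
    simp [symbol, Scan.isUp_succ (z + 2), hu]
  · obtain ⟨z, rfl⟩ := Nat.exists_eq_add_of_le' hx
    rw [out_up z y hu]
    simp [symbol, Scan.isUp_succ (z + 1), hu]

lemma state_up (x y : ℕ) (hx : 1 ≤ x) (hu : Scan.isUp x = true) (hy : y + 1 < w) :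
    state m a x (y + 1) = next w m true y (state m a x y) (symbol m a x y) := by
  obtain ⟨z, rfl⟩ := Nat.exists_eq_add_of_le' hx
  have hc : ((Fin.ofNat 3 (carryAt (value m a z) y) : Fin 3) : ℕ) = carryAt (value m a z) y :=
    Nat.mod_eq_of_lt (carryAt_lt _ _)
  simp only [next, out_up z y hu, if_true, hy.ne, if_false]
  simp only [state, hu, if_true, Nat.add_sub_cancel, CounterState.mk.injEq, symbol, hc,
    carryAt_succ, mod_two_pow_succ_eq_iff, Bool.decide_and, and_self, true_and, and_true]
  constructor <;> congr 1

/-- All numbers compared are at most `m + 1 < 2 ^ w`, so agreement of the lowest `w` bits is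
equality. -/
lemma state_up_last (hm : 0 < m) (hw : m + 1 < 2 ^ w) (x y : ℕ) (hx : 1 ≤ x)
    (hu : Scan.isUp x = true) (hy : y + 1 = w) :
    state m a (x + 1) y = next w m true y (state m a x y) (symbol m a x y) := by
  obtain ⟨z, rfl⟩ := Nat.exists_eq_add_of_le' hx
  have hlt := value_lt (a := a) hm z
  have hlt' := value_lt (a := a) hm (z + 2)
  have h0 : ∀ c ≤ m + 1, (value m a z + 2 = c ↔ (value m a z + 2) % 2 ^ y = c % 2 ^ y ∧
      (value m a z + 2).testBit y = c.testBit y) := by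
    intro c hc
    rw [← mod_two_pow_succ_eq_iff, hy, Nat.mod_eq_of_lt (by omega), Nat.mod_eq_of_lt (by omega)]
  have hdiv : ∀ c < m, c / 2 ^ (y + 1) = 0 := fun c hc =>
    Nat.div_eq_of_lt (by rw [hy]; omega)
  have hud : Scan.isUp (z + 1 + 1) = false := by rw [Scan.isUp_succ, hu]; rfl
  have e0 : decide (value m a z + 2 = m) =
      (decide ((value m a z + 2) % 2 ^ y = m % 2 ^ y) &&
        ((value m a z + 2).testBit y == m.testBit y)) := by
    rw [Bool.beq_eq_decide_eq, ← Bool.decide_and, decide_eq_decide]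
    exact h0 m (by omega)
  have e1 : decide (value m a z + 2 = m + 1) =
      (decide ((value m a z + 2) % 2 ^ y = (m + 1) % 2 ^ y) &&
        ((value m a z + 2).testBit y == (m + 1).testBit y)) := by
    rw [Bool.beq_eq_decide_eq, ← Bool.decide_and, decide_eq_decide]
    exact h0 (m + 1) le_rfl
  simp only [next, out_up z y hu, if_true, hy]
  simp only [state, hu, hud, if_true, Nat.add_sub_cancel, ← e0, ← e1, Bool.false_eq_true,
    if_false, CounterState.mk.injEq, true_and, hdiv _ hlt', hdiv (m - 1) (by omega),
    show z + 1 + 1 - 2 = z by omega, decide_true]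
  rw [show z + 1 + 1 = z + 2 from rfl, value_add_two hm]
  rw [← Bool.decide_and, ← Bool.decide_or, decide_eq_decide]
  split_ifs with c1 c2
  · simp only [c1, true_or]
  · simp [c2]
  · simp only [c1, c2, false_and, or_false]

lemma state_down (hm : 0 < m) (x y : ℕ) (hx : 1 ≤ x) (hu : Scan.isUp x = false) :
    state m a x y = next w m false (y + 1) (state m a x (y + 1)) (symbol m a x (y + 1)) := by
  obtain ⟨z, rfl⟩ : ∃ z, x = z + 2 := by
    refine ⟨x - 2, ?_⟩
    have : x ≠ 1 := by rintro rfl; simp [Scan.isUp] at hu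
    omega
  simp only [next, out_down hm z (y + 1) hu, Bool.false_eq_true, if_false, Nat.succ_ne_zero]
  simp only [state, hu, Bool.false_eq_true, if_false, CounterState.mk.injEq, true_and, and_true]
  rw [Bool.beq_eq_decide_eq, ← Bool.decide_and, decide_eq_decide]
  exact div_two_pow_eq_iff _ _ _

lemma state_down_last (hm : 0 < m) (x : ℕ) (hx : 1 ≤ x) (hu : Scan.isUp x = false) :
    state m a (x + 1) 0 = next w m false 0 (state m a x 0) (symbol m a x 0) := by
  obtain ⟨z, rfl⟩ : ∃ z, x = z + 2 := by
    refine ⟨x - 2, ?_⟩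
    have : x ≠ 1 := by rintro rfl; simp [Scan.isUp] at hu
    omega
  have huu : Scan.isUp (z + 2 + 1) = true := by rw [Scan.isUp_succ, hu]; rfl
  simp only [next, out_down hm z 0 hu, Bool.false_eq_true, if_false, if_true]
  simp only [state, hu, huu, if_true, Bool.false_eq_true, if_false, CounterState.mk.injEq, true_and,
    pow_zero, Nat.mod_one, decide_true]
  refine ⟨by simp [carryAt], ?_⟩
  rw [Bool.beq_eq_decide_eq, ← Bool.decide_and, decide_eq_decide, value_succ_eq_zero hm,
    ← div_two_pow_eq_iff, pow_zero, Nat.div_one, Nat.div_one]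

end Counter

/-! ### Four counters and the logarithmic bound. -/

/-- The machine that runs four counters in parallel. -/
def counterScan (n w : ℕ) (m a : Fin 4 → ℕ) : Scan (Fin 4 → CounterState) (Fin 4 → Bool) where
  n := n
  w := w
  next up k q s c := Counter.next w (m c) up k (q c) (s c)
  out up k q s c := Counter.out (m c) up k (q c) (s c)
  flags q c := (q c).zero
  q x y c := Counter.state (m c) (a c) x y
  s x y c := Counter.symbol (m c) (a c) x y
  φ x c := decide ((x + a c) % m c = 0)

lemma counterScan_run {n w : ℕ} {m a : Fin 4 → ℕ} (h2 : 2 ≤ w) (hwn : w < n)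
    (hm : ∀ c, 0 < m c) (hmw : ∀ c, m c + 1 < 2 ^ w) (hm2 : m 2 = n) (ha2 : a 2 = 0)
    (hm3 : m 3 = n) (ha3 : a 3 = n - w) : (counterScan n w m a).Run where
  two_le := h2
  w_lt := hwn
  flags_q x y _ _ := funext fun c => Counter.state_zero x y
  s_succ x y hx _ := funext fun c => Counter.symbol_succ (hm c) x y hx
  q_up x y hx hu hy := funext fun c => Counter.state_up x y hx hu hy
  q_up_last x y hx hu hy := funext fun c => Counter.state_up_last (hm c) (hmw c) x y hx hu hy
  q_down x y hx hu _ := funext fun c => Counter.state_down (w := w) (hm c) x y hx hu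
  q_down_last x hx hu := funext fun c => Counter.state_down_last (w := w) (hm c) x hx hu
  stop_iff x hx hxn := by
    simp only [counterScan] at hxn ⊢
    rw [decide_eq_true_eq, ha2, hm2, Nat.add_zero]
    constructor
    · intro h
      by_contra hne
      rw [Nat.mod_eq_of_lt (by omega)] at h
      omega
    · rintro rfl
      exact Nat.mod_self _
  diag_iff x hx := by
    simp only [counterScan] at hx ⊢
    rw [decide_eq_true_eq, ha3, hm3]
    constructor
    · intro h
      by_contra hne
      rcases Nat.lt_or_ge (x + (n - w)) n with h' | h'
      · rw [Nat.mod_eq_of_lt h'] at h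
        omega
      · rw [Nat.mod_eq_sub_mod h', Nat.mod_eq_of_lt (by omega)] at h
        omega
    · rintro rfl
      rw [Nat.add_sub_cancel' hwn.le, Nat.mod_self]

/-- Period 0 makes only column or row 0 black, which within the square is the same as period `n`. -/
lemma mod_period_eq_zero_iff {n i x : ℕ} (hx : x < n) :
    x % (if i = 0 then n else i) = 0 ↔ x % i = 0 := by
  split_ifs with h
  · rw [h, Nat.mod_zero, Nat.mod_eq_of_lt hx]
  · rfl

theorem exists_system_card_le_log :
    ∃ K : ℕ, ∀ (A : Type*) [Nonempty A] (C : Type*) (black white : C) (n i j : ℕ), 5 ≤ n →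
      i < n → j < n →
      ∃ (𝒯 : TAS A) (color : TileType A → C), 𝒯.temp = 2 ∧ 𝒯.seed.dom.ncard = 1 ∧
        𝒯.tiles.card ≤ K * (Nat.log 2 n + 2) + 112 ∧
        𝒯.WeaklySelfAssembles color {black, white} (stripes black white n i j) := by
  refine ⟨1 + 2 * (Fintype.card (Fin 4 → CounterState) * Fintype.card (Fin 4 → Bool)), ?_⟩
  intro A _ C black white n i j hn hi hj
  -- This gives `w < n`, and it is where `5 ≤ n` is needed: it fails for `n = 4`.
  have hpow : n < 2 ^ (n - 2) := by
    obtain ⟨k, rfl⟩ := Nat.exists_eq_add_of_le' hn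
    clear hi hj hn
    induction k with
    | zero => norm_num
    | succ k ih =>
      rw [show k + 1 + 5 - 2 = (k + 5 - 2) + 1 by omega, pow_succ]
      omega
  have hlog : Nat.log 2 n < n - 2 := Nat.log_lt_of_lt_pow (by omega) hpow
  have hlt : n < 2 ^ (Nat.log 2 n + 1) := Nat.lt_pow_succ_log_self (by norm_num) n
  set w := Nat.log 2 n + 2 with hw
  have hw2 : 2 * n < 2 ^ w := by
    rw [hw, show Nat.log 2 n + 2 = Nat.log 2 n + 1 + 1 from rfl, pow_succ]
    omega
  let m : Fin 4 → ℕ := ![if i = 0 then n else i, if j = 0 then n else j, n, n]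
  -- The offset `n - w` makes the fourth counter vanish, within the square, exactly in column `w`.
  let a : Fin 4 → ℕ := ![0, 0, 0, n - w]
  have hm : ∀ c, 0 < m c ∧ m c ≤ n := by
    intro c
    fin_cases c <;> simp only [m] <;> simp <;> (try split_ifs) <;> omega
  have hrun : (counterScan n w m a).Run :=
    counterScan_run (by omega) (by omega) (fun c => (hm c).1)
      (fun c => by have := (hm c).2; omega) rfl rfl rfl rfl
  refine hrun.exists_system black white i j ?_ ?_
  · intro x hx
    simpa [counterScan, m, a] using mod_period_eq_zero_iff hx
  · intro x hx
    simpa [counterScan, m, a] using mod_period_eq_zero_iff hx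

end ATAM

theorem theorem3 :
    ∃ f : ℕ → ℝ, f =O[Filter.atTop] (fun n : ℕ => Real.log n) ∧
      ∀ (A : Type*) [Nonempty A] (C : Type*) (black white : C), black ≠ white →
        ∀ n i j : ℕ, i < n → j < n →
          ∃ (𝒯 : ATAM.TAS A) (color : ATAM.TileType A → C),
            𝒯.temp = 2 ∧
            𝒯.seed.dom.ncard = 1 ∧
            (𝒯.tiles.card : ℝ) ≤ f n ∧
            𝒯.WeaklySelfAssembles color {black, white} (ATAM.stripes black white n i j) := by
  obtain ⟨K, hK⟩ := ATAM.exists_system_card_le_log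
  refine ⟨fun n => K * (Nat.log 2 n + 2) + 112, ?_, ?_⟩
  · refine Asymptotics.IsBigO.of_bound (K / Real.log 2 + 2 * K + 112) ?_
    filter_upwards [Filter.eventually_ge_atTop 3] with n hn
    -- This absorbs the constants into multiples of `Real.log n`; 3 exceeds `e`.
    have hlog : 1 ≤ Real.log n := by
      rw [Real.le_log_iff_exp_le (by positivity)]
      have : (3 : ℝ) ≤ n := by exact_mod_cast hn
      linarith [Real.exp_one_lt_d9]
    have hnat : (Nat.log 2 n : ℝ) ≤ Real.log n / Real.log 2 := by
      have := Real.natLog_le_logb n 2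
      simpa [Real.logb] using this
    have hK0 : (0 : ℝ) ≤ K := Nat.cast_nonneg K
    rw [Real.norm_of_nonneg (by positivity), Real.norm_of_nonneg (by linarith)]
    have h1 := mul_le_mul_of_nonneg_left hnat hK0
    have h2 := mul_le_mul_of_nonneg_left hlog hK0
    calc (K : ℝ) * (Nat.log 2 n + 2) + 112
        ≤ K * (Real.log n / Real.log 2) + 2 * (K * Real.log n) + 112 * Real.log n := by linarith
      _ = _ := by ring
  · intro A _ C black white _ n i j hi hj
    by_cases hn : 5 ≤ n
    · obtain ⟨𝒯, color, h1, h2, h3, h4⟩ := hK A C black white n i j hn hi hj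
      exact ⟨𝒯, color, h1, h2, by beta_reduce; exact_mod_cast h3, h4⟩
    · obtain ⟨𝒯, color, h1, h2, h3, h4⟩ :=
        ATAM.exists_system_card_le_sq (A := A) black white (show 0 < n by omega) i j
      refine ⟨𝒯, color, h1, h2, ?_, h4⟩
      -- For `n ≤ 4` the at most 16 tile types are covered by the constant 112.
      have h5 : 𝒯.tiles.card ≤ K * (Nat.log 2 n + 2) + 112 := by
        have : n * n ≤ 4 * 4 := Nat.mul_le_mul (by omega) (by omega)
        omega
      beta_reduce
      exact_mod_cast h5
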